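/- **Setting.** Let $\mathbb N_{\max}=\mathbb N\cup\{-\infty\}$. A max-plus automaton $\mathcal A=\langle Q,\Sigma,M,I,F\rangle$ has a finite set of states $Q$, a finite alphabet $\Sigma$, matrices $M(a)\in\mathbb N_{\max}^{Q\times Q}$ $(a\in\Sigma)$, a row vector $I$ and a column vector $F$ over $\mathbb N_{\max}$. With the $(\max,+)$ matrix product $\otimes$, it computes $f_{\mathcal A}(w_1\cdots w_k)=I\otimes M(w_1)\otimes\cdots\otimes M(w_k)\otimes F$ (and $I\otimes F$ on the empty word). A state $p$ is initial if $I_p\neq-\infty$ and final if $F_p\neq-\infty$; there is a transition $p\xrightarrow{a:x}q$ if $x=M(a)_{p,q}\ne-\infty$. $\mathcal A$ is deterministic if it has at most one initial state and every row of every $M(a)$ has at most one entry $\neq-\infty$. $\mathcal A$ is big-O of $\mathcal B$ (over the same alphabet) if there is a positive integer $c$ with $f_{\mathcal A}(w)\le c f_{\mathcal B}(w)+c$ for all $w\in\Sigma^*$. **Semigroups.** Let $\Omega=\{-\infty,0,1,\infty\}$ with $-\infty<0<1<\infty$, with $\max$ and with the commutative sum for which $-\infty$ is absorbing, $0$ is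 neutral, and $1+1=1$, $1+\infty=\infty+\infty=\infty$. Put $\overline{-\infty}=-\infty$, $\overline0=0$, $\overline x=1$ for integers $x\geq1$ and for $x=\infty$; bars on matrices and vectors are entrywise. Elements are quadruples $(p,x,q,M)$ with $p,q\in Q_{\mathcal A}$, $x\in\Omega$, $M\in\Omega^{Q_{\mathcal B}\times Q_{\mathcal B}}$, and an extra element $\bot$; the product is $(p,x,q,M)(p',x',q',M')=(p,x+x',q',M\otimes M')$ if $q=p'$ and all other products are $\bot$. The semigroup of paths $\overline S$ is generated by the elements $(p,\overline x,q,\overline{M_{\mathcal B}(a)})$ for the transitions $p\xrightarrow{a:x}q$ of $\mathcal A$. A matrix $M$ is path-idempotent if $\overline M\otimes\overline M=\overline M$, and an element $(p,x,q,M)$ is path-idempotent if $p=q$ and $M$ is. Stabilisation: $(-\infty)^\sharp=-\infty$, $0^\sharp=0$, $1^\sharp=\infty^\sharp=\infty$; $M^\sharp=M\otimes M'\otimes M$ where $M'$ is $M$ with its diagonal entries stabilised; $(p,x,p,M)^\sharp=(p,x^\sharp,p,M^\sharp)$. Flattening: $M^\flat=\overline M\otimes\langle M^3\rangle\otimes\overline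 M$ where $\langle N\rangle$ is $N$ with its non-diagonal entries barred; $(p,x,p,M)^\flat=(p,x,p,M^\flat)$. Both are defined on path-idempotent elements. The semigroup of asymptotic behaviours $S$ is the smallest set that contains the generators of $\overline S$ and is closed under product, stabilisation and flattening of path-idempotent elements. **Witnesses.** A witness of non-domination is an element $(p,\infty,q,M)\in S$ with $p$ initial and $q$ final in $\mathcal A$ and $\overline{I_{\mathcal B}}\otimes M\otimes\overline{F_{\mathcal B}}<\infty$. It is tractable if it is of the form $$g_0\bigl(g_1(\cdots(g_{k-1}(g_k)^\sharp g'_{k-1})^\flat\cdots)^\flat g_1'\bigr)^\flat g_0'$$ with $1\le k\le 3|\overline S|$, $g_k\in\overline S$ and $g_i,g_i'\in\overline S\cup\{\mathbf 1\}$ for $i<k$, where $\mathbf 1$ is an added identity and every operation ${}^\sharp$, ${}^\flat$ is applied to a path-idempotent element (so there is one stabilisation and there are $k-1$ nested flattenings). **Trees.** Let $\mathcal A$ be deterministic and let $w=w_1\cdots w_n$ satisfy $f_{\mathcal A}(w)\ne-\infty$, with accepting run $p_0\xrightarrow{w_1:x_1}p_1\cdots\xrightarrow{w_n:x_n}p_n$.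 A factorisation tree on $w$ is a finite ordered tree with nodes labelled in $\overline S$ such that the leaves are labelled, from left to right, by $(p_{i-1},\overline{x_i},p_i,\overline{M_{\mathcal B}(w_i)})$, $i=1,\dots,n$; every internal node has at least two children and is labelled by the product of their labels; and a node with at least three children (an idempotent node) and all its children have the same idempotent label. Leaves have height $0$. Each node has a set of contributors, defined from the root down: - root with matrix $M$: the pairs $(i,j)$ with $i$ initial and $j$ final in $\mathcal B$ and $M_{i,j}\neq-\infty$; - for a node with contributors $C$ and two children with matrices $M$ and $P$: the left child has $\{(i,\ell): M_{i,\ell}\neq-\infty,\ \exists j\,((i,j)\in C,\ P_{\ell,j}\ne-\infty)\}$, the right child has $\{(\ell,j): P_{\ell,j}\neq-\infty,\ \exists i\,((i,j)\in C,\ M_{i,\ell}\neq-\infty)\}$; - for an idempotent node with contributors $C$ and matrix $M$: the left-most and right-most children have the sets just given, with $P=M$; every other child has $\{(\ell,k): M_{\ell,k}\ne-\infty,\ M_{k,\ell}\neq-\infty,\ \exists (i,j)\in C\,(M_{i,\ell}\neq-\infty,\ M_{k,j}\neq-\infty)\}$. A fault is a node that is a child of an idempotent node, but neither the left-most nor the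 right-most one, and has a label $(p,1,q,M)$ with $M_{i,j}=0$ for all its contributors $(i,j)$. **Theorem.** Let $\mathcal A,\mathcal B$ be max-plus automata over the same finite alphabet, with $\mathcal A$ deterministic and $f_{\mathcal B}(w)\ne-\infty$ for all $w\in\Sigma^*$. The following are equivalent: 1. $\mathcal A$ is not big-O of $\mathcal B$; 2. $S$ contains a witness of non-domination; 3. $S$ contains a tractable witness of non-domination; 4. some word has a factorisation tree, of height at most $3|\overline S|$, with a fault. -/

import Mathlib

/-! Max-plus automata, the semigroup of paths and the semigroup of asymptotic behaviours,
witnesses of non-domination, factorisation trees, contributors and faults.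

`WithBot ℕ` is the set of weights `ℕ ∪ {-∞}`; its `+` is absorbing at `⊥ = -∞`. -/

/-- The product of matrices over a structure with operations `max` and `+`:
`(A ⊗ B) i k = max_j (A i j + B j k)`, the empty maximum being `⊥ = -∞`. -/
def mpMul {K m n l : Type*} [SemilatticeSup K] [OrderBot K] [Add K] [Fintype n]
    (A : Matrix m n K) (B : Matrix n l K) : Matrix m l K :=
  fun i k => Finset.univ.sup fun j => A i j + B j k

/-- The scalar `I ⊗ M ⊗ F` for a row vector `I`, a matrix `M` and a column vector `F`. -/
def mpForm {K m n : Type*} [SemilatticeSup K] [OrderBot K] [Add K] [Fintype m] [Fintype n]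
    (I : m → K) (M : Matrix m n K) (F : n → K) : K :=
  Finset.univ.sup fun i => Finset.univ.sup fun j => I i + M i j + F j

/-! ### Max-plus automata -/

/-- A max-plus automaton with alphabet `α` and set of states `Q`. Finiteness of `α` and `Q` is
required by instance arguments where it matters. -/
structure MaxPlusAutomaton (α Q : Type*) where
  /-- the matrix of each letter -/
  M : α → Matrix Q Q (WithBot ℕ)
  /-- the row vector of initial weights -/
  I : Q → WithBot ℕ
  /-- the column vector of final weights -/
  F : Q → WithBot ℕ

namespace MaxPlusAutomaton

variable {α Q R : Type*}

/-- At most one initial state, and at most one entry different from `-∞` in every row of the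
matrix of every letter. -/
def IsDeterministic (A : MaxPlusAutomaton α Q) : Prop :=
  (∀ p q, A.I p ≠ ⊥ → A.I q ≠ ⊥ → p = q) ∧
  ∀ a p q r, A.M a p q ≠ ⊥ → A.M a p r ≠ ⊥ → q = r

open Classical in
/-- The extension of `M` to words; the empty word is sent to the unit matrix (`0` on the diagonal
and `-∞` elsewhere). -/
noncomputable def wordMat [Fintype Q] (A : MaxPlusAutomaton α Q) :
    List α → Matrix Q Q (WithBot ℕ)
  | [] => fun p q => if p = q then 0 else ⊥
  | a :: w => mpMul (A.M a) (A.wordMat w)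

/-- The weighting function computed by the automaton. -/
noncomputable def weight [Fintype Q] (A : MaxPlusAutomaton α Q) (w : List α) : WithBot ℕ :=
  mpForm A.I (A.wordMat w) A.F

/-- `A` is big-O of `B`. -/
def IsBigO [Fintype Q] [Fintype R] (A : MaxPlusAutomaton α Q) (B : MaxPlusAutomaton α R) : Prop :=
  ∃ c : ℕ, 0 < c ∧ ∀ w : List α, A.weight w ≤ (c : WithBot ℕ) * B.weight w + (c : WithBot ℕ)

end MaxPlusAutomaton

/-! ### The semiring `{-∞, 0, 1, ∞}` -/

/-- The set `{-∞, 0, 1, ∞}`. -/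
inductive Omega where
  | ninf : Omega
  | zero : Omega
  | one : Omega
  | inf : Omega
deriving DecidableEq

namespace Omega

instance : Fintype Omega where
  elems := {ninf, zero, one, inf}
  complete := by intro x; cases x <;> decide

/-- Position in the order `-∞ < 0 < 1 < ∞`. -/
def rank : Omega → ℕ
  | ninf => 0
  | zero => 1
  | one => 2
  | inf => 3

theorem rank_injective : Function.Injective rank := by
  intro x y h
  cases x <;> cases y <;> first | rfl | cases h

instance : LinearOrder Omega := LinearOrder.lift' rank rank_injective

instance : OrderBot Omega where
  bot := ninf
  bot_le := fun x => Nat.zero_le (rank x)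

/-- The sum on `{-∞, 0, 1, ∞}`: `-∞` is absorbing, `0` is neutral, `1 + 1 = 1`,
`1 + ∞ = ∞ + ∞ = ∞`. -/
protected def add : Omega → Omega → Omega
  | ninf, _ => ninf
  | _, ninf => ninf
  | zero, y => y
  | x, zero => x
  | one, one => one
  | one, inf => inf
  | inf, one => inf
  | inf, inf => inf

instance : Add Omega := ⟨Omega.add⟩

theorem bot_add (x : Omega) : ⊥ + x = ⊥ := by revert x; decide
theorem add_bot (x : Omega) : x + ⊥ = ⊥ := by revert x; decide
theorem add_assoc3 (x y z : Omega) : x + y + z = x + (y + z) := by revert x y z; decide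
theorem add_sup (x y z : Omega) : x + (y ⊔ z) = (x + y) ⊔ (x + z) := by revert x y z; decide
theorem sup_add (x y z : Omega) : (x ⊔ y) + z = (x + z) ⊔ (y + z) := by revert x y z; decide

/-- The projection of `{-∞, 0, 1, ∞}` onto `{-∞, 0, 1}`. -/
def bar : Omega → Omega
  | ninf => ninf
  | zero => zero
  | one => one
  | inf => one

/-- The stabilisation of scalars. -/
def stab : Omega → Omega
  | ninf => ninf
  | zero => zero
  | one => inf
  | inf => inf

/-- The projection of `ℕ ∪ {-∞}` onto `{-∞, 0, 1}`. -/
def ofWeight (x : WithBot ℕ) : Omega :=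
  if x = ⊥ then ninf else if x = 0 then zero else one

theorem add_finset_sup {ι : Type*} (s : Finset ι) (x : Omega) (f : ι → Omega) :
    x + s.sup f = s.sup fun i => x + f i := by
  classical
  induction s using Finset.induction_on with
  | empty => simp [add_bot]
  | insert i s _ ih => simp only [Finset.sup_insert, add_sup, ih]

theorem finset_sup_add {ι : Type*} (s : Finset ι) (x : Omega) (f : ι → Omega) :
    s.sup f + x = s.sup fun i => f i + x := by
  classical
  induction s using Finset.induction_on with
  | empty => simp [bot_add]
  | insert i s _ ih => simp only [Finset.sup_insert, sup_add, ih]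

theorem mpMul_assoc {R : Type*} [Fintype R] (M N P : Matrix R R Omega) :
    mpMul (mpMul M N) P = mpMul M (mpMul N P) := by
  funext i l
  simp only [mpMul, finset_sup_add, add_finset_sup, add_assoc3]
  rw [Finset.sup_comm]

end Omega

/-! ### Operations on matrices over `{-∞, 0, 1, ∞}` -/

section Matrices

variable {R : Type*}

/-- The entrywise projection. -/
def barMat (M : Matrix R R Omega) : Matrix R R Omega := fun i j => (M i j).bar

/-- The entrywise projection of a matrix over `ℕ ∪ {-∞}`. -/
def projMat (M : Matrix R R (WithBot ℕ)) : Matrix R R Omega := fun i j => Omega.ofWeight (M i j)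

/-- `M` is path-idempotent. -/
def IsPathIdemMat [Fintype R] (M : Matrix R R Omega) : Prop :=
  mpMul (barMat M) (barMat M) = barMat M

open Classical in
/-- The matrix `M` with its diagonal entries replaced by their stabilisations. -/
noncomputable def stabDiag (M : Matrix R R Omega) : Matrix R R Omega :=
  fun i j => if i = j then (M i j).stab else M i j

open Classical in
/-- The matrix `⟨M⟩`: `M` with its non-diagonal entries replaced by their projections. -/
noncomputable def barOffDiag (M : Matrix R R Omega) : Matrix R R Omega :=
  fun i j => if i = j then M i j else (M i j).bar

/-- Stabilisation `M ⊗ M' ⊗ M` of a matrix, where `M' = stabDiag M`. -/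
noncomputable def stabMat [Fintype R] (M : Matrix R R Omega) : Matrix R R Omega :=
  mpMul (mpMul M (stabDiag M)) M

/-- Flattening of a matrix: the projection of `M`, times `⟨M ⊗ M ⊗ M⟩`, times the projection
of `M`. -/
noncomputable def flatMat [Fintype R] (M : Matrix R R Omega) : Matrix R R Omega :=
  mpMul (mpMul (barMat M) (barOffDiag (mpMul (mpMul M M) M))) (barMat M)

end Matrices

/-! ### The ambient semigroup of quadruples -/

/-- Quadruples `(p, x, q, M)`, together with an extra element `⊥`, here `bot`. -/
inductive PathElt (Q R : Type*) where
  | bot : PathElt Q R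
  | mk (p : Q) (x : Omega) (q : Q) (M : Matrix R R Omega) : PathElt Q R

namespace PathElt

variable {Q R : Type*}

open Classical in
/-- `(p, x, q, M) ⊗ (p', x', q', M') = (p, x + x', q', M ⊗ M')` if `q = p'`, and `⊥` otherwise. -/
protected noncomputable def mul [Fintype R] : PathElt Q R → PathElt Q R → PathElt Q R
  | mk p x q M, mk p' x' q' M' => if q = p' then mk p (x + x') q' (mpMul M M') else bot
  | _, _ => bot

noncomputable instance [Fintype R] : Semigroup (PathElt Q R) where
  mul := PathElt.mul
  mul_assoc := by
    intro a b c
    change PathElt.mul (PathElt.mul a b) c = PathElt.mul a (PathElt.mul b c)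
    cases a <;> cases b <;> cases c <;> simp only [PathElt.mul] <;>
      split_ifs <;> simp_all [Omega.add_assoc3, Omega.mpMul_assoc]

instance [Finite Q] [Finite R] : Finite (PathElt Q R) := by
  let f : PathElt Q R → Option (Q × Omega × Q × Matrix R R Omega) := fun e =>
    match e with
    | bot => none
    | mk p x q M => some (p, x, q, M)
  have hf : Function.Injective f := by
    intro a b h
    cases a <;> cases b <;> simp_all [f]
  have : Finite (Matrix R R Omega) := inferInstanceAs (Finite (R → R → Omega))
  exact Finite.of_injective f hf

/-- The second component (`-∞` for `⊥`). -/
def val : PathElt Q R → Omega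
  | bot => Omega.ninf
  | mk _ x _ _ => x

/-- The matrix component (constantly `-∞` for `⊥`). -/
def mat : PathElt Q R → Matrix R R Omega
  | bot => fun _ _ => Omega.ninf
  | mk _ _ _ M => M

/-- Path-idempotent elements: `(p, x, p, M)` with `M` path-idempotent. -/
def IsPathIdem [Fintype R] : PathElt Q R → Prop
  | bot => False
  | mk p _ q M => p = q ∧ IsPathIdemMat M

/-- Stabilisation (only meaningful on path-idempotent elements). -/
noncomputable def stab [Fintype R] : PathElt Q R → PathElt Q R
  | bot => bot
  | mk p x q M => mk p x.stab q (stabMat M)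

/-- Flattening (only meaningful on path-idempotent elements). -/
noncomputable def flat [Fintype R] : PathElt Q R → PathElt Q R
  | bot => bot
  | mk p x q M => mk p x q (flatMat M)

end PathElt

/-! ### The semigroups attached to two automata -/

section Semigroups

variable {α Q R : Type*}

/-- The element attached to the letter `a` and the states `p`, `q` of `A`. -/
def letterElt (A : MaxPlusAutomaton α Q) (B : MaxPlusAutomaton α R) (a : α) (p q : Q) :
    PathElt Q R :=
  PathElt.mk p (Omega.ofWeight (A.M a p q)) q (projMat (B.M a))

/-- The elements attached to the transitions of `A`. -/
def letterElts (A : MaxPlusAutomaton α Q) (B : MaxPlusAutomaton α R) : Set (PathElt Q R) :=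
  {e | ∃ a p q, A.M a p q ≠ ⊥ ∧ e = letterElt A B a p q}

/-- The semigroup of paths. All generators have their entries in `{-∞, 0, 1}`, which is closed
under `max` and `+` in `{-∞, 0, 1, ∞}`, so that the subsemigroup can be taken here. -/
noncomputable def pathSemigroup [Fintype R] (A : MaxPlusAutomaton α Q) (B : MaxPlusAutomaton α R) :
    Subsemigroup (PathElt Q R) :=
  Subsemigroup.closure (letterElts A B)

/-- Membership in the semigroup of asymptotic behaviours: the least set of elements that contains
the generators and is closed under product and under the stabilisation and the flattening of
path-idempotent elements. -/
inductive IsAsymptotic [Fintype R] (A : MaxPlusAutomaton α Q) (B : MaxPlusAutomaton α R) :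
    PathElt Q R → Prop
  | letter {e : PathElt Q R} : e ∈ letterElts A B → IsAsymptotic A B e
  | mul {e f : PathElt Q R} : IsAsymptotic A B e → IsAsymptotic A B f → IsAsymptotic A B (e * f)
  | stab {e : PathElt Q R} : IsAsymptotic A B e → e.IsPathIdem → IsAsymptotic A B e.stab
  | flat {e : PathElt Q R} : IsAsymptotic A B e → e.IsPathIdem → IsAsymptotic A B e.flat

/-- `g` is a witness of non-domination. -/
def IsWitness [Fintype R] (A : MaxPlusAutomaton α Q) (B : MaxPlusAutomaton α R)
    (g : PathElt Q R) : Prop :=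
  IsAsymptotic A B g ∧
  ∃ p q M, g = PathElt.mk p Omega.inf q M ∧ A.I p ≠ ⊥ ∧ A.F q ≠ ⊥ ∧
    mpForm (fun i => Omega.ofWeight (B.I i)) M (fun j => Omega.ofWeight (B.F j)) < Omega.inf

/-- The semigroup of paths with an added identity element. -/
def pathSemigroupOne [Fintype R] (A : MaxPlusAutomaton α Q) (B : MaxPlusAutomaton α R) :
    Set (WithOne (PathElt Q R)) :=
  {u | u = 1 ∨ ∃ e ∈ pathSemigroup A B, u = (e : WithOne (PathElt Q R))}

/-- `IsNested A B n h` says that `h` is obtained from a stabilisation by `n` nested flattenings: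
`h = (g₁ (⋯ (gₙ (gₙ₊₁)^♯ gₙ')^♭ ⋯)^♭ g₁')^♭`, with `gₙ₊₁` in the semigroup of paths and all other
`gᵢ`, `gᵢ'` in the semigroup of paths with an added identity. All the stabilisations and
flattenings are applied to path-idempotent elements. -/
inductive IsNested [Fintype R] (A : MaxPlusAutomaton α Q) (B : MaxPlusAutomaton α R) :
    ℕ → PathElt Q R → Prop
  | stab {g : PathElt Q R} : g ∈ pathSemigroup A B → g.IsPathIdem → IsNested A B 0 g.stab
  | flat {n : ℕ} {h e : PathElt Q R} {u v : WithOne (PathElt Q R)} :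
      IsNested A B n h → u ∈ pathSemigroupOne A B → v ∈ pathSemigroupOne A B →
      (e : WithOne (PathElt Q R)) = u * (h : WithOne (PathElt Q R)) * v →
      e.IsPathIdem → IsNested A B (n + 1) e.flat

/-- `g` is a tractable witness of non-domination: a witness of the form
`g₀ (g₁ (⋯ (gₖ₋₁ (gₖ)^♯ gₖ₋₁')^♭ ⋯)^♭ g₁')^♭ g₀'` with `1 ≤ k`, `k` at most three times the size
of the semigroup of paths. Here `k = n + 1`, where `n` is the number of flattenings. -/
def IsTractableWitness [Fintype R] (A : MaxPlusAutomaton α Q) (B : MaxPlusAutomaton α R)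
    (g : PathElt Q R) : Prop :=
  IsWitness A B g ∧
  ∃ n h u v, n + 1 ≤ 3 * Nat.card (pathSemigroup A B) ∧ IsNested A B n h ∧
    u ∈ pathSemigroupOne A B ∧ v ∈ pathSemigroupOne A B ∧
    (g : WithOne (PathElt Q R)) = u * (h : WithOne (PathElt Q R)) * v

end Semigroups

/-! ### Factorisation trees -/

/-- Finite ordered trees with labelled nodes, in which an internal node has either two children
or `m + 3` children for some `m`. -/
inductive FactTree (S : Type*) where
  | leaf (e : S) : FactTree S
  | prod (e : S) (l r : FactTree S) : FactTree S
  | idem (e : S) (m : ℕ) (c : Fin (m + 3) → FactTree S) : FactTree S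

namespace FactTree

variable {S : Type*}

/-- The label of the root. -/
def label : FactTree S → S
  | leaf e => e
  | prod e _ _ => e
  | idem e _ _ => e

/-- The labels of the leaves, from left to right. -/
def leaves : FactTree S → List S
  | leaf e => [e]
  | prod _ l r => l.leaves ++ r.leaves
  | idem _ _ c => (List.ofFn fun i => (c i).leaves).flatten

/-- The height; a leaf has height `0`. -/
def height : FactTree S → ℕ
  | leaf _ => 0
  | prod _ l r => max l.height r.height + 1
  | idem _ _ c => (Finset.univ.sup fun i => (c i).height) + 1

/-- The conditions on labels: a node with two children is labelled by the product of their labels,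
and a node with at least three children has the same idempotent label as all of its children (this
label is then also the product of the labels of the children). -/
def IsValid [Mul S] : FactTree S → Prop
  | leaf _ => True
  | prod e l r => e = l.label * r.label ∧ l.IsValid ∧ r.IsValid
  | idem e _ c => e * e = e ∧ ∀ i, (c i).label = e ∧ (c i).IsValid

end FactTree

section Trees

variable {α Q R : Type*}

/-- `IsRun A B p w q L`: there is a run of `A` from `p` to `q` labelled by `w`, and `L` is the list
of the elements attached to its transitions. -/
inductive IsRun (A : MaxPlusAutomaton α Q) (B : MaxPlusAutomaton α R) :
    Q → List α → Q → List (PathElt Q R) → Prop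
  | nil (p : Q) : IsRun A B p [] p []
  | cons {p q r : Q} {a : α} {w : List α} {L : List (PathElt Q R)} :
      A.M a p q ≠ ⊥ → IsRun A B q w r L →
      IsRun A B p (a :: w) r (letterElt A B a p q :: L)

/-- `t` is a factorisation tree on the word `w`; in particular `A` has an accepting run on `w`,
that is, the weight of `w` is not `-∞`. If `A` is deterministic, then this run is unique. -/
def IsFactTreeOn [Fintype R] (A : MaxPlusAutomaton α Q) (B : MaxPlusAutomaton α R)
    (w : List α) (t : FactTree (pathSemigroup A B)) : Prop :=
  t.IsValid ∧ ∃ p q, A.I p ≠ ⊥ ∧ A.F q ≠ ⊥ ∧ IsRun A B p w q (t.leaves.map Subtype.val)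

/-! ### Contributors and faults -/

/-- The contributors of the root, whose label has matrix `M`. -/
def rootContrib (B : MaxPlusAutomaton α R) (M : Matrix R R Omega) : Set (R × R) :=
  {z | B.I z.1 ≠ ⊥ ∧ B.F z.2 ≠ ⊥ ∧ M z.1 z.2 ≠ Omega.ninf}

/-- The contributors of a left-most child with matrix `M`, followed by the matrix `P`, below a node
with contributors `C`. -/
def leftContrib (M P : Matrix R R Omega) (C : Set (R × R)) : Set (R × R) :=
  {z | ∃ j, (z.1, j) ∈ C ∧ P z.2 j ≠ Omega.ninf ∧ M z.1 z.2 ≠ Omega.ninf}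

/-- The contributors of a right-most child with matrix `P`, preceded by the matrix `M`, below a node
with contributors `C`. -/
def rightContrib (M P : Matrix R R Omega) (C : Set (R × R)) : Set (R × R) :=
  {z | ∃ i, (i, z.2) ∈ C ∧ M i z.1 ≠ Omega.ninf ∧ P z.1 z.2 ≠ Omega.ninf}

/-- The contributors of the other children of an idempotent node with matrix `M` and contributors
`C`. -/
def middleContrib (M : Matrix R R Omega) (C : Set (R × R)) : Set (R × R) :=
  {z | ∃ i j, (i, j) ∈ C ∧ M i z.1 ≠ Omega.ninf ∧ M z.2 j ≠ Omega.ninf ∧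
    M z.1 z.2 ≠ Omega.ninf ∧ M z.2 z.1 ≠ Omega.ninf}

/-- `IsNode A B t ν C b`: the tree `t` has a node at which the subtree `ν` is rooted and whose set of
contributors is `C`; `b` tells whether this node is a child of an idempotent node other than its
left-most and its right-most child. -/
inductive IsNode [Fintype R] (A : MaxPlusAutomaton α Q) (B : MaxPlusAutomaton α R)
    (t : FactTree (pathSemigroup A B)) :
    FactTree (pathSemigroup A B) → Set (R × R) → Bool → Prop
  | root : IsNode A B t t (rootContrib B t.label.1.mat) false
  | prodLeft {e : pathSemigroup A B} {l r : FactTree (pathSemigroup A B)}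
      {C : Set (R × R)} {b : Bool} : IsNode A B t (.prod e l r) C b →
      IsNode A B t l (leftContrib l.label.1.mat r.label.1.mat C) false
  | prodRight {e : pathSemigroup A B} {l r : FactTree (pathSemigroup A B)}
      {C : Set (R × R)} {b : Bool} : IsNode A B t (.prod e l r) C b →
      IsNode A B t r (rightContrib l.label.1.mat r.label.1.mat C) false
  | idemLeft {e : pathSemigroup A B} {m : ℕ} {c : Fin (m + 3) → FactTree (pathSemigroup A B)}
      {C : Set (R × R)} {b : Bool} : IsNode A B t (.idem e m c) C b →
      IsNode A B t (c 0) (leftContrib e.1.mat e.1.mat C) false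
  | idemRight {e : pathSemigroup A B} {m : ℕ} {c : Fin (m + 3) → FactTree (pathSemigroup A B)}
      {C : Set (R × R)} {b : Bool} : IsNode A B t (.idem e m c) C b →
      IsNode A B t (c (Fin.last (m + 2))) (rightContrib e.1.mat e.1.mat C) false
  | idemMiddle {e : pathSemigroup A B} {m : ℕ} {c : Fin (m + 3) → FactTree (pathSemigroup A B)}
      {C : Set (R × R)} {b : Bool} {i : Fin (m + 3)} : IsNode A B t (.idem e m c) C b →
      i ≠ 0 → i ≠ Fin.last (m + 2) →
      IsNode A B t (c i) (middleContrib e.1.mat C) true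

/-- Some node of the tree `t` is a fault: a middle child of an idempotent node, with label
`(p, 1, q, M)` such that `M i j = 0` for all its contributors `(i, j)`. -/
def HasFault [Fintype R] (A : MaxPlusAutomaton α Q) (B : MaxPlusAutomaton α R)
    (t : FactTree (pathSemigroup A B)) : Prop :=
  ∃ ν C, IsNode A B t ν C true ∧ ν.label.1.val = Omega.one ∧
    ∀ z ∈ C, ν.label.1.mat z.1 z.2 = Omega.zero

end Trees

/-! The proof is the cycle 1 → 4 → 3 → 2 → 1, in which only 3 → 2 is immediate.

1 → 4 (`exists_fault_of_not_isBigO`), by contraposition. Simon's theorem (`exists_factTree`) gives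
every accepting run on a nonempty word a factorisation tree of height at most three times the size
of the semigroup of paths. If the tree has no fault, then `IsNode.isBounded` shows, from the leaves
up, that the weight of the run of `A` below a node is linearly bounded by an entry of the matrix of
`B` at some contributor. At an idempotent node, every middle child of positive weight has a
contributor with entry `1`; its positive weight absorbs the additive constant, and the weights of
many middle children can be collected by one run of `B` around a loop (`sum_le_wordMat_of_loop`).
The constant depends on the height only, hence not on the word.

4 → 3 (`exists_tractableWitness_of_fault`). A fault permits a stabilisation at its parent that turns
the `A`-component into `∞` but puts no `∞` at a contributor of that parent. This lift climbs to the
root: binary nodes and extreme children multiply it by elements of the semigroup of paths, and a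
middle child costs one flattening (`HasLift.flat`). The height thus bounds the number of
flattenings.

2 → 1 (`not_isBigO_of_isWitness`). Each asymptotic behaviour describes actual words
(`IsAsymptotic.isRealised`): if its value is `∞`, some word has `A`-weight exceeding any prescribed
linear function of the entries of `B` not marked `∞`. Stabilisation and flattening correspond to
taking a high power of a word, and `wordMat_replicate_le` controls the entries of such a power. -/

/-! ### Stability in finite monoids -/

section FiniteMonoid

variable {M : Type*} [Monoid M]

/-- The two-sided divisibility preorder of a monoid: `x` has `y` as a factor. -/
def JLe (x y : M) : Prop := ∃ u v, x = u * y * v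

theorem JLe.refl (x : M) : JLe x x := ⟨1, 1, by simp⟩

theorem JLe.trans {x y z : M} (h : JLe x y) (h' : JLe y z) : JLe x z := by
  obtain ⟨u, v, rfl⟩ := h
  obtain ⟨u', v', rfl⟩ := h'
  exact ⟨u * u', v' * v, by simp only [mul_assoc]⟩

theorem jle_mul_left (x y : M) : JLe (x * y) y := ⟨x, 1, by simp⟩

theorem jle_mul_right (x y : M) : JLe (x * y) x := ⟨1, y, by simp⟩

/-- Stability of finite monoids. Iterating `x = u(xy)v` gives `x = uⁿ x (yv)ⁿ`; by finiteness two of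
the elements `x (yv)ⁿ` coincide, and multiplying this coincidence by `uᵐ` on the left leaves `x = x
(yv)ᵏ⁺¹`. -/
theorem exists_eq_mul_right_of_jle [Finite M] {x y : M} (h : JLe x (x * y)) :
    ∃ v, x = x * y * v := by
  obtain ⟨u, v, h⟩ := h
  have hn : ∀ n : ℕ, x = u ^ n * x * (y * v) ^ n := by
    intro n
    induction n with
    | zero => simp
    | succ n ih =>
      calc x = u ^ n * (u * (x * y) * v) * (y * v) ^ n := by rw [← h]; exact ih
        _ = u ^ (n + 1) * x * (y * v) ^ (n + 1) := by
          rw [pow_succ u, pow_succ' (y * v)]; simp only [mul_assoc]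
  obtain ⟨m, n, hmn, he⟩ := Finite.exists_ne_map_eq_of_infinite fun n : ℕ => x * (y * v) ^ n
  wlog hlt : m < n generalizing m n
  · exact this n m hmn.symm he.symm (by omega)
  obtain ⟨k, rfl⟩ := Nat.exists_eq_add_of_lt hlt
  refine ⟨v * (y * v) ^ k, ?_⟩
  calc x = u ^ m * x * (y * v) ^ m := hn m
    _ = u ^ m * (x * (y * v) ^ m) := by rw [mul_assoc]
    _ = u ^ m * x * (y * v) ^ m * (y * v) ^ (k + 1) := by
      rw [he, add_assoc, pow_add]; simp only [mul_assoc]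
    _ = x * (y * v) ^ (k + 1) := by rw [← hn m]
    _ = _ := by rw [pow_succ']; simp only [mul_assoc]

theorem exists_eq_mul_left_of_jle [Finite M] {x y : M} (h : JLe x (y * x)) :
    ∃ v, x = v * (y * x) := by
  obtain ⟨u, v, h⟩ := h
  have : Finite Mᵐᵒᵖ := Finite.of_equiv _ MulOpposite.opEquiv
  have h' : JLe (MulOpposite.op x) (MulOpposite.op x * MulOpposite.op y) :=
    ⟨MulOpposite.op v, MulOpposite.op u, by
      apply MulOpposite.unop_injective; simpa [mul_assoc] using h⟩
  obtain ⟨w, hw⟩ := exists_eq_mul_right_of_jle h'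
  exact ⟨w.unop, by simpa using congrArg MulOpposite.unop hw⟩

/-- `x` and `y` generate the same right ideal. -/
def REq (x y : M) : Prop := (∃ v, x = y * v) ∧ ∃ v, y = x * v

/-- `x` and `y` generate the same left ideal. -/
def LEq (x y : M) : Prop := (∃ v, x = v * y) ∧ ∃ v, y = v * x

theorem REq.refl (x : M) : REq x x := ⟨⟨1, by simp⟩, ⟨1, by simp⟩⟩

theorem REq.symm {x y : M} (h : REq x y) : REq y x := ⟨h.2, h.1⟩

theorem REq.trans {x y z : M} (h : REq x y) (h' : REq y z) : REq x z := by
  obtain ⟨⟨a, ha⟩, ⟨b, hb⟩⟩ := h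
  obtain ⟨⟨c, hc⟩, ⟨d, hd⟩⟩ := h'
  exact ⟨⟨c * a, by rw [← mul_assoc, ← hc, ha]⟩, ⟨b * d, by rw [← mul_assoc, ← hb, hd]⟩⟩

theorem LEq.symm {x y : M} (h : LEq x y) : LEq y x := ⟨h.2, h.1⟩

theorem LEq.trans {x y z : M} (h : LEq x y) (h' : LEq y z) : LEq x z := by
  obtain ⟨⟨a, ha⟩, ⟨b, hb⟩⟩ := h
  obtain ⟨⟨c, hc⟩, ⟨d, hd⟩⟩ := h'
  exact ⟨⟨a * c, by rw [mul_assoc, ← hc, ha]⟩, ⟨d * b, by rw [mul_assoc, ← hb, hd]⟩⟩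

theorem req_mul_of_jle [Finite M] {x y : M} (h : JLe x (x * y)) : REq (x * y) x :=
  ⟨⟨y, rfl⟩, exists_eq_mul_right_of_jle h⟩

theorem leq_mul_of_jle [Finite M] {x y : M} (h : JLe x (y * x)) : LEq (y * x) x :=
  ⟨⟨y, rfl⟩, exists_eq_mul_left_of_jle h⟩

/-- Two idempotents generating the same left and the same right ideals are equal. -/
theorem idem_eq_of_req_of_leq {x y : M} (hx : x * x = x) (hy : y * y = y) (hr : REq x y)
    (hl : LEq x y) : x = y := by
  obtain ⟨u, hu⟩ := hr.1
  obtain ⟨v, hv⟩ := hl.2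
  have h1 : y * x = x := by rw [hu, ← mul_assoc, hy]
  have h2 : y * x = y := by rw [hv, mul_assoc, hx]
  rw [← h1, h2]

end FiniteMonoid

/-! ### Factorisation forests -/

section Forest

/-- The concatenation of the blocks `x a, …, x (b - 1)`. -/
def blockSeg {T : Type*} (x : ℕ → List T) (a b : ℕ) : List T := ((List.Ico a b).map x).flatten

theorem blockSeg_append {T : Type*} (x : ℕ → List T) {a b c : ℕ} (hab : a ≤ b) (hbc : b ≤ c) :
    blockSeg x a c = blockSeg x a b ++ blockSeg x b c := by
  simp [blockSeg, ← List.Ico.append_consecutive hab hbc]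

theorem blockSeg_succ {T : Type*} (x : ℕ → List T) (a : ℕ) : blockSeg x a (a + 1) = x a := by
  simp [blockSeg, List.Ico.succ_singleton]

theorem blockSeg_self {T : Type*} (x : ℕ → List T) (a : ℕ) : blockSeg x a a = [] := by
  simp [blockSeg]

variable {S : Type*} [Semigroup S]

/-- The product of a list, in the semigroup with an added identity. -/
def listVal (l : List S) : WithOne S := (l.map (fun a => (a : WithOne S))).prod

@[simp] theorem listVal_nil : listVal ([] : List S) = 1 := rfl

@[simp] theorem listVal_append (l l' : List S) : listVal (l ++ l') = listVal l * listVal l' := by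
  simp [listVal]

@[simp] theorem listVal_singleton (a : S) : listVal [a] = a := by simp [listVal]

theorem FactTree.IsValid.label_eq {t : FactTree S} (h : t.IsValid) :
    (t.label : WithOne S) = listVal t.leaves := by
  induction t with
  | leaf e => simp [FactTree.label, FactTree.leaves]
  | prod e l r ihl ihr =>
    obtain ⟨rfl, hl, hr⟩ := h
    simp [FactTree.label, FactTree.leaves, ← ihl hl, ← ihr hr]
  | idem e m c ih =>
    obtain ⟨he, hc⟩ := h
    have key : ∀ n (L : Fin (n + 1) → List S), (∀ i, listVal (L i) = e) →
        listVal (List.ofFn L).flatten = e := by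
      intro n
      induction n with
      | zero => intro L hL; simp [hL]
      | succ n ihn =>
        intro L hL
        rw [List.ofFn_succ, List.flatten_cons, listVal_append, hL, ihn _ fun i => hL _,
          ← WithOne.coe_mul, he]
    exact (key (m + 2) _ fun i => by rw [← ih i (hc i).2, (hc i).1]).symm

/-- Some factorisation tree of height at most `h` has the leaves `l`. -/
def HasTree (l : List S) (h : ℕ) : Prop :=
  ∃ t : FactTree S, t.IsValid ∧ t.leaves = l ∧ t.height ≤ h

theorem HasTree.mono {l : List S} {h h' : ℕ} (H : HasTree l h) (hh : h ≤ h') : HasTree l h' := by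
  obtain ⟨t, h1, h2, h3⟩ := H
  exact ⟨t, h1, h2, h3.trans hh⟩

theorem hasTree_singleton (a : S) (h : ℕ) : HasTree [a] h :=
  ⟨.leaf a, trivial, rfl, Nat.zero_le _⟩

theorem HasTree.append {l l' : List S} {h : ℕ} (H : HasTree l h) (H' : HasTree l' h) :
    HasTree (l ++ l') (h + 1) := by
  obtain ⟨t, h1, h2, h3⟩ := H
  obtain ⟨t', h1', h2', h3'⟩ := H'
  refine ⟨.prod (t.label * t'.label) t t', ⟨rfl, h1, h1'⟩, by simp [FactTree.leaves, h2, h2'], ?_⟩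
  simp only [FactTree.height]
  omega

/-- One or two lists need no idempotent node; from three on, the common idempotent value allows all
trees to hang from a single node, whatever their number. -/
theorem HasTree.flatten {L : List (List S)} {h : ℕ} {e : WithOne S} (hL : L ≠ [])
    (H : ∀ l ∈ L, HasTree l h) (hv : ∀ l ∈ L, listVal l = e) (he : e * e = e) :
    HasTree L.flatten (h + 1) := by
  match L, hL with
  | [l], _ => simpa using (H l (by simp)).mono (Nat.le_succ h)
  | [l, l'], _ => simpa using (H l (by simp)).append (H l' (by simp))
  | l₁ :: l₂ :: l₃ :: L', _ =>
    set L := l₁ :: l₂ :: l₃ :: L' with hLdef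
    have hlen : L.length = L'.length + 3 := rfl
    choose t ht using fun i : Fin (L'.length + 3) => H (L.get i) (L.get_mem i)
    have hlab : ∀ i, ((t i).label : WithOne S) = e := fun i => by
      rw [(ht i).1.label_eq, (ht i).2.1]; exact hv _ (L.get_mem i)
    refine ⟨.idem (t 0).label L'.length t, ⟨?_, fun i => ⟨?_, (ht i).1⟩⟩, ?_, ?_⟩
    · rw [← WithOne.coe_inj, WithOne.coe_mul, hlab, he]
    · rw [← WithOne.coe_inj, hlab, hlab]
    · simp only [FactTree.leaves]
      congr 1
      rw [show (fun i => (t i).leaves) = L.get from funext fun i => (ht i).2.1]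
      exact List.ofFn_get L
    · simp only [FactTree.height]
      simpa using fun i => (ht i).2.2

/-- Cutting a sequence of blocks at all cuts with the colour of its first cut. -/
theorem exists_split_at_colour {C : Type*} {x : ℕ → List S} {col : ℕ → C}
    {P : C → WithOne S → Prop} {k h : ℕ}
    (hcol : ∀ i j, i < j → j < k → col i = col j → P (col i) (listVal (blockSeg x i j)))
    (c : C) (Γ : Finset C)
    (hΓ : ∀ a b, a < b → b ≤ k → (∀ i, a < i → i < b → col i ∈ Γ) → HasTree (blockSeg x a b) h) :
    ∀ n a b, b - a = n → a < b → b ≤ k → col a = c →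
      (∀ i, a < i → i < b → col i = c ∨ col i ∈ Γ) →
      ∃ (L : List (List S)) (last : List S), blockSeg x a b = L.flatten ++ last ∧
        (∀ l ∈ L, HasTree l h ∧ P c (listVal l)) ∧ HasTree last h := by
  intro n
  induction n using Nat.strong_induction_on with
  | _ n ih =>
    intro a b hn hab hbk hac hi
    -- Cut at the first later index of colour `c`: no index before it has colour `c`, so the piece
    -- only meets colours of `Γ`.
    by_cases hex : ∃ i, a < i ∧ i < b ∧ col i = c
    · classical
      obtain ⟨h1, h2, h3⟩ := Nat.find_spec hex
      set i := Nat.find hex with hidef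
      have hmin : ∀ j, a < j → j < i → col j ∈ Γ := fun j hj hji =>
        (hi j hj (by omega)).resolve_left fun hc => Nat.find_min hex hji ⟨hj, by omega, hc⟩
      obtain ⟨L, last, e1, e2, e3⟩ := ih (b - i) (by omega) i b rfl h2 hbk h3
        fun j hj hjb => hi j (by omega) hjb
      refine ⟨blockSeg x a i :: L, last, ?_, ?_, e3⟩
      · rw [blockSeg_append x h1.le h2.le, e1]; simp
      · intro l hl
        rcases List.mem_cons.1 hl with rfl | hl
        · exact ⟨hΓ a i h1 (by omega) hmin, hac ▸ hcol a i h1 (by omega) (hac.trans h3.symm)⟩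
        · exact e2 l hl
    · refine ⟨[], blockSeg x a b, by simp, by simp, hΓ a b hab hbk fun i h1 h2 => ?_⟩
      exact (hi i h1 h2).resolve_left fun hc => hex ⟨i, h1, h2, hc⟩

/-- The pieces with a common idempotent value cost one level, and attaching the last piece costs
another. -/
theorem hasTree_of_split {L : List (List S)} {last : List S} {h : ℕ} {e : WithOne S}
    (H : ∀ l ∈ L, HasTree l h) (hv : ∀ l ∈ L, listVal l = e) (he : L ≠ [] → e * e = e)
    (Hl : HasTree last (h + 1)) : HasTree (L.flatten ++ last) (h + 2) := by
  by_cases hL : L = []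
  · subst hL; simpa using Hl.mono (by omega)
  · exact (HasTree.flatten hL H hv (he hL)).append Hl

/-- If the blocks between cuts of the same colour have the same idempotent product, then every
colour increases the height by at most three. -/
theorem hasTree_of_colouring {C : Type*} {x : ℕ → List S} {col : ℕ → C}
    {P : C → WithOne S → Prop} {k h : ℕ}
    (hP : ∀ c y y', P c y → P c y' → y = y') (hidem : ∀ c y, P c y → y * y = y)
    (hcol : ∀ i j, i < j → j < k → col i = col j → P (col i) (listVal (blockSeg x i j)))
    (hx : ∀ i < k, HasTree (x i) h) (Γ : Finset C) :
    ∀ a b, a < b → b ≤ k → (∀ i, a < i → i < b → col i ∈ Γ) →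
      HasTree (blockSeg x a b) (h + 3 * Γ.card) := by
  classical
  induction Γ using Finset.strongInduction with
  | H Γ ih =>
    intro a b hab hbk hi
    by_cases hab' : a + 1 = b
    · subst hab'
      rw [blockSeg_succ]
      exact (hx a (by omega)).mono (by omega)
    -- Only cuts strictly inside the interval are known to have their colour in `Γ`, so block `a` is
    -- set apart and the colour of the cut `a + 1` is eliminated. The three levels are: the
    -- idempotent node, the last piece, and block `a`.
    set c := col (a + 1) with hc
    have hcΓ : c ∈ Γ := hi _ (by omega) (by omega)
    have hcard := Finset.card_erase_add_one hcΓ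
    obtain ⟨L, last, e1, e2, e3⟩ := exists_split_at_colour hcol c (Γ.erase c)
      (ih _ (Finset.erase_ssubset hcΓ)) _ (a + 1) b rfl (by omega) hbk hc.symm
      (fun i h1 h2 => by
        by_cases hic : col i = c
        · exact .inl hic
        · exact .inr (Finset.mem_erase.2 ⟨hic, hi i (by omega) h2⟩))
    have hT : HasTree (L.flatten ++ last) (h + 3 * (Γ.erase c).card + 2) := by
      by_cases hL : L = []
      · subst hL; simpa using e3.mono (by omega)
      obtain ⟨l₀, hl₀⟩ := List.exists_mem_of_ne_nil L hL
      exact hasTree_of_split (fun l hl => (e2 l hl).1)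
        (fun l hl => hP c _ _ (e2 l hl).2 (e2 l₀ hl₀).2) (fun _ => hidem c _ (e2 l₀ hl₀).2)
        (e3.mono (by omega))
    rw [blockSeg_append x (Nat.le_succ a) (by omega : a + 1 ≤ b), blockSeg_succ, e1]
    exact (((hx a (by omega)).mono (by omega)).append hT).mono (by omega)

/-- A variant in which the first cut is coloured too, and a last piece is added. -/
theorem hasTree_of_colouring_append {C : Type*} {x : ℕ → List S} {col : ℕ → C}
    {P : C → WithOne S → Prop} {k h : ℕ}
    (hP : ∀ c y y', P c y → P c y' → y = y') (hidem : ∀ c y, P c y → y * y = y)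
    (hcol : ∀ i j, i < j → j < k → col i = col j → P (col i) (listVal (blockSeg x i j)))
    (hx : ∀ i < k, HasTree (x i) h) (Γ : Finset C) (hk : 0 < k) (hΓ : ∀ i < k, col i ∈ Γ)
    {v : List S} (hv : v = [] ∨ HasTree v h) :
    HasTree (blockSeg x 0 k ++ v) (h + 3 * Γ.card - 1) := by
  classical
  -- Here the cut `0` has its colour in `Γ`, so no first block is set apart and one level is saved;
  -- the extra piece `v` joins `last` within the remaining levels.
  set c := col 0 with hc
  have hcΓ : c ∈ Γ := hΓ 0 hk
  have hcard := Finset.card_erase_add_one hcΓ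
  obtain ⟨L, last, e1, e2, e3⟩ := exists_split_at_colour hcol c (Γ.erase c)
    (hasTree_of_colouring hP hidem hcol hx (Γ.erase c)) _ 0 k rfl hk le_rfl hc.symm
    (fun i h1 h2 => by
      by_cases hic : col i = c
      · exact .inl hic
      · exact .inr (Finset.mem_erase.2 ⟨hic, hΓ i h2⟩))
  have hlast : HasTree (last ++ v) (h + 3 * (Γ.erase c).card + 1) := by
    rcases hv with rfl | hv
    · simpa using e3.mono (by omega)
    · exact e3.append (hv.mono (by omega))
  rw [e1, List.append_assoc]
  have hT : HasTree (L.flatten ++ (last ++ v)) (h + 3 * (Γ.erase c).card + 2) := by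
    by_cases hL : L = []
    · subst hL; simpa using hlast.mono (by omega)
    obtain ⟨l₀, hl₀⟩ := List.exists_mem_of_ne_nil L hL
    exact hasTree_of_split (fun l hl => (e2 l hl).1)
      (fun l hl => hP c _ _ (e2 l hl).2 (e2 l₀ hl₀).2) (fun _ => hidem c _ (e2 l₀ hl₀).2) hlast
  exact hT.mono (by omega)

end Forest

/-! ### Two-sided classes and the proof of the factorisation forest theorem -/

section JClass

variable {S : Type*} [Semigroup S]

instance [Finite S] : Finite (WithOne S) := inferInstanceAs (Finite (Option S))

theorem REq.mul_left {M : Type*} [Monoid M] {x y : M} (h : REq x y) (z : M) :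
    REq (z * x) (z * y) := by
  obtain ⟨⟨a, ha⟩, ⟨b, hb⟩⟩ := h
  exact ⟨⟨a, by rw [mul_assoc, ← ha]⟩, ⟨b, by rw [mul_assoc, ← hb]⟩⟩

theorem REq.jle {M : Type*} [Monoid M] {x y : M} (h : REq x y) : JLe x y := by
  obtain ⟨⟨a, rfl⟩, -⟩ := h
  exact jle_mul_right _ _

/-- A choice of left translations from one right class to the others of the same two-sided class,
which only depends on the right class of the argument. -/
theorem exists_translation {M : Type*} [Monoid M] [Finite M] (s p : M) (hp : JLe s p)
    (hp' : JLe p s) : ∃ t : M → M, (∀ y y', REq y y' → t y = t y') ∧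
      ∀ y, JLe s y → JLe y s → REq (t y * p) y := by
  let st : Setoid M := ⟨REq, REq.refl, REq.symm, REq.trans⟩
  -- An element `y` of the class is `u p v`; as `u p` lies in the class too, stability makes it
  -- right-equivalent to `u p v = y`.
  have h : ∀ y, JLe s y → JLe y s → ∃ u, REq (u * p) y := by
    intro y h1 h2
    obtain ⟨u, v, huv⟩ := h2.trans hp
    refine ⟨u, ?_⟩
    have h3 : JLe (u * p) (u * p * v) := by
      rw [← huv]; exact ((jle_mul_left u p).trans hp').trans h1
    have h4 := (req_mul_of_jle h3).symm
    rwa [← huv] at h4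
  classical
  -- The translation is chosen for a representative of the right class, so that it is constant on
  -- right classes.
  let g : M → M := fun y => if hy : ∃ u, REq (u * p) y then hy.choose else 1
  refine ⟨fun y => g (Quotient.mk st y).out, fun y y' hyy => ?_, fun y h1 h2 => ?_⟩
  · simp only [show Quotient.mk st y = Quotient.mk st y' from Quotient.sound hyy]
  · have ho : REq (Quotient.mk st y).out y := Quotient.mk_out (s := st) y
    obtain ⟨u, hu⟩ := h y h1 h2
    have hex : ∃ u, REq (u * p) (Quotient.mk st y).out := ⟨u, hu.trans ho.symm⟩
    simp only [g, dif_pos hex]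
    exact hex.choose_spec.trans ho

/-- A two-sided class containing a product `y * y'` of two of its elements contains an element `p`
such that it also contains `p * y`. -/
theorem exists_left_factor {M : Type*} [Monoid M] [Finite M] {s y y' : M} (hy : JLe s (y * y'))
    (h1 : JLe y s) (h2 : JLe y' s) : ∃ p, JLe s p ∧ JLe p s ∧ JLe s (p * y) := by
  have hsy : JLe s y := hy.trans (jle_mul_right _ _)
  -- Now `y'v` fixes `y` from the right, and stability gives `y'v = zy`. Hence `yzy = y`, and `p =
  -- yz` fixes `y` from the left.
  obtain ⟨v, hv⟩ := exists_eq_mul_right_of_jle (h1.trans hy)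
  have he : JLe (y' * v) (y * (y' * v)) := by
    rw [← mul_assoc, ← hv]
    exact ((jle_mul_right _ _).trans h2).trans hsy
  obtain ⟨z, hz⟩ := exists_eq_mul_left_of_jle he
  rw [← mul_assoc y, ← hv] at hz
  have hyz : y * z * y = y := by rw [mul_assoc, ← hz, ← mul_assoc, ← hv]
  refine ⟨y * z, ?_, (jle_mul_right _ _).trans h1, by rwa [hyz]⟩
  have := jle_mul_right (y * z) y
  rw [hyz] at this
  exact hsy.trans this

/-- Blocks with products in one two-sided class. -/
theorem hasTree_of_jclass [Finite S] {s : WithOne S} {X : List (List S)} {v : List S} {h : ℕ} (hX : X ≠ [])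
    (hXs : ∀ x ∈ X, JLe (listVal x) s) (hs : JLe s (listVal X.flatten))
    (hXh : ∀ x ∈ X, HasTree x h) (hv : v = [] ∨ HasTree v h) :
    HasTree (X.flatten ++ v) (h + 3 * {c : WithOne S | JLe s c ∧ JLe c s}.ncard - 1) := by
  set J : Set (WithOne S) := {c : WithOne S | JLe s c ∧ JLe c s} with hJ
  have hcard : 1 ≤ J.ncard := by
    rw [Nat.one_le_iff_ne_zero, ← Nat.pos_iff_ne_zero, Set.ncard_pos (Set.toFinite _)]
    exact ⟨s, JLe.refl s, JLe.refl s⟩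
  -- The element `p` below comes from a product of two blocks staying in the class, so a single
  -- block is treated apart.
  by_cases hlen : X.length = 1
  · obtain ⟨x, rfl⟩ := List.length_eq_one_iff.1 hlen
    rcases hv with rfl | hv
    · simpa using (hXh x (by simp)).mono (by omega)
    · simpa using ((hXh x (by simp)).append hv).mono (by omega)
  set k := X.length with hk
  have hk2 : 2 ≤ k := by
    have := List.length_pos_iff.2 hX
    omega
  set x : ℕ → List S := fun i => X.getD i [] with hx
  have hxmem : ∀ i < k, x i ∈ X := fun i hi => by
    simp only [hx, List.getD_eq_getElem _ _ hi]; exact List.getElem_mem hi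
  have hflat : X.flatten = blockSeg x 0 k := by
    rw [blockSeg]
    congr 1
    apply List.ext_getElem
    · simp [hk]
    · intro i h1 h2
      simp [hx, List.Ico.zero_bot, List.getElem?_eq_getElem h1]
  set π : ℕ → ℕ → WithOne S := fun i j => listVal (blockSeg x i j) with hπ
  have hπmul : ∀ a b c, a ≤ b → b ≤ c → π a c = π a b * π b c := fun a b c h1 h2 => by
    simp only [hπ, blockSeg_append x h1 h2, listVal_append]
  have hπy : ∀ i, π i (i + 1) = listVal (x i) := fun i => by simp only [hπ, blockSeg_succ]
  have hsπ : ∀ i j, i ≤ j → j ≤ k → JLe s (π i j) := fun i j hij hjk => by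
    refine hs.trans ?_
    rw [hflat, show listVal (blockSeg x 0 k) = π 0 k from rfl, hπmul 0 i k (by omega) (by omega),
      hπmul i j k hij hjk]
    exact (jle_mul_left _ _).trans (jle_mul_right _ _)
  have hys : ∀ i < k, JLe (listVal (x i)) s := fun i hi => hXs _ (hxmem i hi)
  have hsy : ∀ i < k, JLe s (listVal (x i)) := fun i hi => hπy i ▸ hsπ i (i + 1) (by omega) hi
  have hπs : ∀ i j, i < j → j ≤ k → JLe (π i j) s := fun i j hij hjk => by
    rw [hπmul i (i + 1) j (by omega) (by omega), hπy]
    exact (jle_mul_right _ _).trans (hys i (by omega))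
  obtain ⟨p, hsp, hps, hspy⟩ := exists_left_factor (s := s) (y := listVal (x 0))
    (y' := listVal (x 1))
    (by rw [← hπy, ← hπy, ← hπmul 0 1 2 (by omega) (by omega)]; exact hsπ 0 2 (by omega) hk2)
    (hys 0 (by omega)) (hys 1 (by omega))
  have hsP : ∀ j ≤ k, JLe s (p * π 0 j) := by
    intro j hj
    rcases Nat.eq_zero_or_pos j with rfl | hj0
    · simpa [hπ, blockSeg_self] using hsp
    · obtain ⟨w, hw⟩ := exists_eq_mul_left_of_jle (x := listVal (x 0)) (y := p)
        ((hys 0 (by omega)).trans hspy)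
      refine (hsπ 0 j (by omega) hj).trans ⟨w, 1, ?_⟩
      rw [hπmul 0 1 j (by omega) hj0, hπy, mul_one, ← mul_assoc p, ← mul_assoc w, ← hw]
  have hPp : ∀ j ≤ k, REq (p * π 0 j) p := fun j hj => req_mul_of_jle (hps.trans (hsP j hj))
  obtain ⟨t, ht1, ht2⟩ := exists_translation s p hsp hps
  have htp : ∀ i < k, REq (t (listVal (x i)) * (p * π 0 i)) (listVal (x i)) := fun i hi =>
    ((hPp i hi.le).mul_left _).trans (ht2 _ (hsy i hi) (hys i hi))
  have hJf : J.Finite := Set.toFinite J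
  rw [hflat, Set.ncard_eq_toFinset_card J hJf]
  -- All `p * π 0 i` are right-equivalent to `p`, and translation by `t` moves them into the right
  -- class of block `i`. The colour thus lies in the class `J`, records the right class of block
  -- `i`, and keeps the left class of `p * π 0 i`. The property `P` says: idempotent, with the left
  -- and right class of the colour; there is at most one such element.
  refine hasTree_of_colouring_append (x := x) (k := k)
    (col := fun i => t (listVal (x i)) * (p * π 0 i))
    (P := fun c y => y * y = y ∧ REq y c ∧ LEq y c) ?_ (fun c y hy => hy.1) ?_
    (fun i hi => hXh _ (hxmem i hi)) hJf.toFinset (by omega) ?_ hv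
  · rintro c y y' ⟨h1, h2, h3⟩ ⟨h1', h2', h3'⟩
    exact idem_eq_of_req_of_leq h1 h1' (h2.trans h2'.symm) (h3.trans h3'.symm)
  · intro i j hij hjk hc
    have hyy : REq (listVal (x j)) (listVal (x i)) :=
      ((htp j hjk).symm.trans (hc ▸ REq.refl _)).trans (htp i (by omega))
    rw [ht1 _ _ hyy] at hc
    set τ := t (listVal (x i)) with hτ
    have hτp : JLe p (τ * p) :=
      (hps.trans (hsy i (by omega))).trans (ht2 _ (hsy i (by omega)) (hys i (by omega))).symm.jle
    obtain ⟨w, hw⟩ := exists_eq_mul_left_of_jle hτp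
    have hcancel : ∀ z, w * (τ * (p * z)) = p * z := fun z => by
      rw [← mul_assoc τ, ← mul_assoc w, ← hw]
    -- Translation by `t` can be undone on multiples of `p`, so equal colours mean equal `p * π 0 i`
    -- and `p * π 0 j`. Hence `π i j` fixes `p * π 0 i`, to which it is also left-equivalent, and is
    -- therefore idempotent.
    have hPij : p * π 0 i = p * π 0 j := by rw [← hcancel, hc, hcancel]
    have hPy : p * π 0 i * π i j = p * π 0 i := by
      rw [mul_assoc, ← hπmul 0 i j (by omega) hij.le, hPij]
    have hyP : LEq (p * π 0 i * π i j) (π i j) := leq_mul_of_jle (by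
      rw [hPy]; exact (hπs i j hij hjk.le).trans (hsP i (by omega)))
    rw [hPy] at hyP
    refine ⟨?_, ?_, ?_⟩
    · change π i j * π i j = π i j
      obtain ⟨z, hz⟩ := hyP.2
      calc π i j * π i j = z * (p * π 0 i) * π i j := by rw [← hz]
        _ = π i j := by rw [mul_assoc, hPy, ← hz]
    · refine REq.trans ?_ (htp i (by omega)).symm
      change REq (π i j) _
      rw [hπmul i (i + 1) j (by omega) hij, hπy]
      refine req_mul_of_jle ?_
      rw [← hπy, ← hπmul i (i + 1) j (by omega) hij, hπy]
      exact (hys i (by omega)).trans (hsπ i j hij.le hjk.le)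
    · refine hyP.symm.trans (leq_mul_of_jle ?_).symm
      exact ((jle_mul_right _ _).trans (hps.trans (hsy i (by omega)))).trans
        (htp i (by omega)).symm.jle
  · intro i hi
    rw [Set.Finite.mem_toFinset]
    exact ⟨(hsy i hi).trans (htp i hi).symm.jle, (htp i hi).jle.trans (hys i hi)⟩

/-- The greedy factorisation into blocks with product in the two-sided class of `s`, followed by a
last piece with product strictly above `s`. -/
theorem exists_greedy_split {s : WithOne S} {h : ℕ}
    (hh : ∀ l : List S, l ≠ [] → JLe s (listVal l) → ¬ JLe (listVal l) s → HasTree l h)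
    (l : List S) (hl : JLe s (listVal l)) :
    ∃ (X : List (List S)) (v : List S), l = X.flatten ++ v ∧
      (∀ x ∈ X, JLe (listVal x) s ∧ HasTree x (h + 1)) ∧
      (v = [] ∨ (¬ JLe (listVal v) s ∧ HasTree v h)) := by
  induction l using List.reverseRecOn with
  | nil => exact ⟨[], [], by simp⟩
  | append_singleton l a ih =>
    obtain ⟨X, v, rfl, hX, hv⟩ := ih (hl.trans (by
      rw [listVal_append]; exact jle_mul_right _ _))
    by_cases hva : JLe (listVal (v ++ [a])) s
    · refine ⟨X ++ [v ++ [a]], [], by simp, ?_, .inl rfl⟩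
      intro x hx
      rcases List.mem_append.1 hx with hx | hx
      · exact hX x hx
      · rw [List.mem_singleton.1 hx]
        refine ⟨hva, ?_⟩
        rcases hv with rfl | hv
        · exact hasTree_singleton a _
        · exact hv.2.append (hasTree_singleton a _)
    · refine ⟨X, v ++ [a], by simp, hX, .inr ⟨hva, hh _ (by simp) (hl.trans ?_) hva⟩⟩
      rw [List.append_assoc, listVal_append]
      exact jle_mul_left _ _

theorem listVal_ne_one {l : List S} (hl : l ≠ []) : listVal l ≠ 1 := by
  obtain ⟨a, l, rfl⟩ := List.exists_cons_of_ne_nil hl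
  clear hl
  induction l generalizing a with
  | nil => simp
  | cons b l ih =>
    have : listVal (a :: b :: l) = listVal ((a * b) :: l) := by simp [listVal, mul_assoc]
    rw [this]
    exact ih _

theorem not_one_jle {s : WithOne S} (hs : s ≠ 1) : ¬ JLe 1 s := by
  rintro ⟨u, v, h⟩
  obtain ⟨s, rfl⟩ := WithOne.ne_one_iff_exists.1 hs
  by_cases hu : u = 1 <;> by_cases hv : v = 1
  · subst hu hv
    simp at h
  · obtain ⟨v, rfl⟩ := WithOne.ne_one_iff_exists.1 hv
    subst hu
    simp [← WithOne.coe_mul] at h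
  · obtain ⟨u, rfl⟩ := WithOne.ne_one_iff_exists.1 hu
    subst hv
    simp [← WithOne.coe_mul] at h
  · obtain ⟨u, rfl⟩ := WithOne.ne_one_iff_exists.1 hu
    obtain ⟨v, rfl⟩ := WithOne.ne_one_iff_exists.1 hv
    simp [← WithOne.coe_mul] at h

/-- Induction on the number of non-identity elements that divide the product. If the class of the
product has `d` elements, pieces strictly above it have height at most `3(n - d)`, greedy blocks one
more, and assembling the blocks costs `3d - 1`: in all `3n`. -/
theorem hasTree_of_ne_nil [Finite S] : ∀ (n : ℕ) (l : List S), l ≠ [] →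
    {t : WithOne S | t ≠ 1 ∧ JLe (listVal l) t}.ncard = n → HasTree l (3 * n) := by
  intro n
  induction n using Nat.strong_induction_on with
  | _ n ih =>
    intro l hl hn
    set s := listVal l with hs
    set J : Set (WithOne S) := {c : WithOne S | JLe s c ∧ JLe c s} with hJ
    have hcardJ : 1 ≤ J.ncard := by
      rw [Nat.one_le_iff_ne_zero, ← Nat.pos_iff_ne_zero, Set.ncard_pos (Set.toFinite _)]
      exact ⟨s, JLe.refl s, JLe.refl s⟩
    have hs1 : s ≠ 1 := listVal_ne_one hl
    set U : Set (WithOne S) := {t : WithOne S | t ≠ 1 ∧ JLe s t} with hU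
    have hJU : J ⊆ U := fun c hc => ⟨fun h1 => not_one_jle hs1 (h1 ▸ hc.2), hc.1⟩
    have hdiff : (U \ J).ncard + J.ncard = n := by
      rw [← hn]; exact Set.ncard_sdiff_add_ncard_of_subset hJU
    have hh : ∀ l : List S, l ≠ [] → JLe s (listVal l) → ¬ JLe (listVal l) s →
        HasTree l (3 * (U \ J).ncard) := by
      intro l' hl' h1 h2
      have hle : {t : WithOne S | t ≠ 1 ∧ JLe (listVal l') t}.ncard ≤ (U \ J).ncard := by
        apply Set.ncard_le_ncard _ (Set.toFinite _)
        intro t ht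
        exact ⟨⟨ht.1, h1.trans ht.2⟩, fun htJ => h2 (ht.2.trans htJ.2)⟩
      exact (ih _ (by omega) l' hl' rfl).mono (by omega)
    obtain ⟨X, v, hl', hX, hv⟩ := exists_greedy_split hh l (JLe.refl s)
    have hXne : X ≠ [] := by
      rintro rfl
      rw [List.flatten_nil, List.nil_append] at hl'
      subst hl'
      rcases hv with hv | hv
      · exact hl hv
      · exact hv.1 (JLe.refl _)
    have key := hasTree_of_jclass (s := s) (v := v) (h := 3 * (U \ J).ncard + 1) hXne
      (fun x hx => (hX x hx).1)
      (by rw [hs, hl', listVal_append]; exact jle_mul_right _ _) (fun x hx => (hX x hx).2)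
      (hv.imp id fun h => h.2.mono (by omega))
    rw [← hJ] at key
    rw [hl']
    exact key.mono (by omega)

/-- Simon's factorisation forest theorem: every nonempty word over a finite semigroup has a
factorisation tree of height at most three times the size of the semigroup. -/
theorem exists_factTree [Finite S] {l : List S} (hl : l ≠ []) :
    ∃ t : FactTree S, t.IsValid ∧ t.leaves = l ∧ t.height ≤ 3 * Nat.card S := by
  refine (hasTree_of_ne_nil _ l hl rfl).mono (Nat.mul_le_mul_left 3 ?_)
  have hsub : {t : WithOne S | t ≠ 1 ∧ JLe (listVal l) t} ⊆
      Set.range (fun a : S => (a : WithOne S)) := by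
    rintro t ⟨ht, -⟩
    obtain ⟨a, rfl⟩ := WithOne.ne_one_iff_exists.1 ht
    exact ⟨a, rfl⟩
  refine (Set.ncard_le_ncard hsub (Set.toFinite _)).trans ?_
  rw [← Set.image_univ, ← Set.ncard_univ]
  exact Set.ncard_image_le (Set.toFinite _)

end JClass

/-! ### Calculus in `{-∞, 0, 1, ∞}` -/

namespace Omega

theorem ninf_eq_bot : ninf = ⊥ := rfl

@[simp] theorem bar_bar (x : Omega) : x.bar.bar = x.bar := by revert x; decide
theorem bar_add (x y : Omega) : (x + y).bar = x.bar + y.bar := by revert x y; decide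
theorem bar_sup (x y : Omega) : (x ⊔ y).bar = x.bar ⊔ y.bar := by revert x y; decide
@[simp] theorem bar_eq_ninf (x : Omega) : x.bar = ninf ↔ x = ninf := by revert x; decide
@[simp] theorem bar_ne_inf (x : Omega) : x.bar ≠ inf := by revert x; decide
@[simp] theorem bar_stab (x : Omega) : x.stab.bar = x.bar := by revert x; decide
theorem add_eq_inf {x y : Omega} :
    x + y = inf ↔ x = inf ∧ y ≠ ninf ∨ x ≠ ninf ∧ y = inf := by revert x y; decide
theorem add_eq_ninf {x y : Omega} : x + y = ninf ↔ x = ninf ∨ y = ninf := by revert x y; decide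
theorem sup_eq_inf {x y : Omega} : x ⊔ y = inf ↔ x = inf ∨ y = inf := by revert x y; decide
theorem lt_inf {x : Omega} : x < inf ↔ x ≠ inf := by revert x; decide

theorem finset_sup_eq_inf {ι : Type*} {s : Finset ι} {f : ι → Omega} :
    s.sup f = inf ↔ ∃ i ∈ s, f i = inf := by
  classical
  induction s using Finset.induction_on with
  | empty => simp [← ninf_eq_bot]
  | insert i s _ ih => simp [sup_eq_inf, ih]

theorem finset_sup_eq_ninf {ι : Type*} {s : Finset ι} {f : ι → Omega} :
    s.sup f = ninf ↔ ∀ i ∈ s, f i = ninf := by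
  simp [ninf_eq_bot]

theorem bar_finset_sup {ι : Type*} (s : Finset ι) (f : ι → Omega) :
    (s.sup f).bar = s.sup fun i => (f i).bar := by
  classical
  induction s using Finset.induction_on with
  | empty => rfl
  | insert i s _ ih => simp only [Finset.sup_insert, bar_sup, ih]

end Omega

/-! ### Projections of matrices, and where `∞` can arise -/

section OmegaMatrices

variable {R : Type*}

theorem Omega.bar_ofWeight (x : WithBot ℕ) : (Omega.ofWeight x).bar = Omega.ofWeight x := by
  unfold Omega.ofWeight
  split_ifs <;> rfl

theorem Omega.ofWeight_eq_ninf {x : WithBot ℕ} : Omega.ofWeight x = Omega.ninf ↔ x = ⊥ := by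
  unfold Omega.ofWeight
  split_ifs <;> simp_all

theorem barMat_projMat (M : Matrix R R (WithBot ℕ)) : barMat (projMat M) = projMat M := by
  funext i j; exact Omega.bar_ofWeight _

theorem ne_inf_of_barMat_eq {M N : Matrix R R Omega} (h : barMat N = M) {i j : R} :
    M i j ≠ Omega.inf := by
  rw [← h]; exact Omega.bar_ne_inf _

theorem barMat_barMat (M : Matrix R R Omega) : barMat (barMat M) = barMat M := by
  funext i j; simp [barMat]

theorem barMat_eq_ninf {M : Matrix R R Omega} {i j : R} :
    barMat M i j = Omega.ninf ↔ M i j = Omega.ninf := Omega.bar_eq_ninf _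

theorem ne_ninf_of_barMat_eq {M N : Matrix R R Omega} (h : barMat N = M) {i j : R}
    (hij : N i j ≠ Omega.ninf) : M i j ≠ Omega.ninf := by
  rwa [← h, Ne, barMat_eq_ninf]

theorem barMat_stabDiag (M : Matrix R R Omega) : barMat (stabDiag M) = barMat M := by
  funext i j
  simp only [barMat, stabDiag]
  split_ifs <;> simp

theorem barMat_barOffDiag (M : Matrix R R Omega) : barMat (barOffDiag M) = barMat M := by
  funext i j
  simp only [barMat, barOffDiag]
  split_ifs <;> simp

variable [Fintype R]

theorem barMat_mpMul (M N : Matrix R R Omega) :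
    barMat (mpMul M N) = mpMul (barMat M) (barMat N) := by
  funext i j
  simp only [barMat, mpMul, Omega.bar_finset_sup, Omega.bar_add]

theorem mpMul_ne_ninf {M N : Matrix R R Omega} {i j : R} :
    mpMul M N i j ≠ Omega.ninf ↔ ∃ k, M i k ≠ Omega.ninf ∧ N k j ≠ Omega.ninf := by
  simp [mpMul, Omega.finset_sup_eq_ninf, Omega.add_eq_ninf]

theorem mpMul_eq_inf {M N : Matrix R R Omega} {i j : R} :
    mpMul M N i j = Omega.inf ↔ ∃ k, M i k = Omega.inf ∧ N k j ≠ Omega.ninf ∨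
      M i k ≠ Omega.ninf ∧ N k j = Omega.inf := by
  simp [mpMul, Omega.finset_sup_eq_inf, Omega.add_eq_inf]

theorem barMat_stabMat {M : Matrix R R Omega} (h : IsPathIdemMat M) :
    barMat (stabMat M) = barMat M := by
  rw [stabMat, barMat_mpMul, barMat_mpMul, barMat_stabDiag, h, h]

theorem barMat_flatMat {M : Matrix R R Omega} (h : IsPathIdemMat M) :
    barMat (flatMat M) = barMat M := by
  rw [flatMat, barMat_mpMul, barMat_mpMul, barMat_barOffDiag, barMat_mpMul, barMat_mpMul,
    barMat_barMat, h, h, h, h]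

theorem IsPathIdemMat.trans_ne_ninf {M : Matrix R R Omega} (h : IsPathIdemMat M) {i j k : R}
    (hij : M i j ≠ Omega.ninf) (hjk : M j k ≠ Omega.ninf) : M i k ≠ Omega.ninf := by
  rw [Ne, ← barMat_eq_ninf, ← h]
  exact mpMul_ne_ninf.2 ⟨j, by rwa [Ne, barMat_eq_ninf], by rwa [Ne, barMat_eq_ninf]⟩

theorem stabMat_eq_inf {M : Matrix R R Omega} {i j : R} (hM : barMat M = M)
    (h : stabMat M i j = Omega.inf) :
    ∃ k, M i k ≠ Omega.ninf ∧ M k k = Omega.one ∧ M k j ≠ Omega.ninf := by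
  have hfin : ∀ a b, M a b ≠ Omega.inf := fun a b hab => by
    rw [← hM] at hab; exact Omega.bar_ne_inf _ hab
  obtain ⟨l, hl⟩ := mpMul_eq_inf.1 h
  rcases hl with ⟨hl, hlj⟩ | ⟨-, hl⟩
  · obtain ⟨k, hk⟩ := mpMul_eq_inf.1 hl
    rcases hk with ⟨hk, -⟩ | ⟨hik, hk⟩
    · exact absurd hk (hfin _ _)
    · by_cases hkl : k = l
      · subst hkl
        refine ⟨k, hik, ?_, hlj⟩
        have := hfin k k
        simp only [stabDiag, if_true] at hk
        revert this hk
        cases M k k <;> decide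
      · rw [stabDiag, if_neg hkl] at hk
        exact absurd hk (hfin _ _)
  · exact absurd hl (hfin _ _)

/-- All factors of the flattening are projected except the diagonal of the cube, so an `∞` must come
from there. -/
theorem flatMat_eq_inf {M : Matrix R R Omega} {i j : R} (h : flatMat M i j = Omega.inf) :
    ∃ k, M i k ≠ Omega.ninf ∧ mpMul (mpMul M M) M k k = Omega.inf ∧ M k j ≠ Omega.ninf := by
  obtain ⟨l, hl⟩ := mpMul_eq_inf.1 h
  rcases hl with ⟨hl, hlj⟩ | ⟨-, hl⟩
  · obtain ⟨k, hk⟩ := mpMul_eq_inf.1 hl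
    rcases hk with ⟨hk, -⟩ | ⟨hik, hk⟩
    · exact absurd hk (Omega.bar_ne_inf _)
    · by_cases hkl : k = l
      · subst hkl
        rw [barOffDiag, if_pos rfl] at hk
        exact ⟨k, by rwa [Ne, barMat_eq_ninf] at hik, hk, by rwa [Ne, barMat_eq_ninf] at hlj⟩
      · rw [barOffDiag, if_neg hkl] at hk
        exact absurd hk (Omega.bar_ne_inf _)
  · exact absurd hl (Omega.bar_ne_inf _)

end OmegaMatrices

/-! ### The semigroup of paths -/

namespace PathElt

variable {Q R : Type*} [Fintype R]

theorem mk_mul_mk (p q s : Q) (x y : Omega) (M N : Matrix R R Omega) :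
    (mk p x q M : PathElt Q R) * mk q y s N = mk p (x + y) s (mpMul M N) := by
  change PathElt.mul _ _ = _
  simp [PathElt.mul]

theorem mul_ne_bot {e f : PathElt Q R} (h : e * f ≠ bot) : ∃ p q s x y M N,
    e = mk p x q M ∧ f = mk q y s N := by
  change PathElt.mul e f ≠ bot at h
  cases e <;> cases f <;> simp only [PathElt.mul, ne_eq, not_true_eq_false] at h
  split_ifs at h with hq
  · subst hq
    exact ⟨_, _, _, _, _, _, _, rfl, rfl⟩
  · exact absurd rfl h

theorem idem_eq {e : PathElt Q R} (he : e * e = e) (hb : e ≠ bot) :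
    ∃ p x M, e = mk p x p M ∧ mpMul M M = M := by
  obtain ⟨p, q, s, x, y, M, N, h1, h2⟩ := mul_ne_bot (he.symm ▸ hb)
  rw [h1] at h2
  obtain ⟨rfl, rfl, rfl, rfl⟩ := mk.inj h2
  refine ⟨p, x, M, h1, ?_⟩
  rw [h1, mk_mul_mk] at he
  exact (mk.inj he).2.2.2

end PathElt

/-! ### Lifting a fault to a witness -/

section Faults

variable {α Q R : Type*} [Fintype R] {A : MaxPlusAutomaton α Q} {B : MaxPlusAutomaton α R}

theorem pathSemigroup_bar {e : PathElt Q R} (he : e ∈ pathSemigroup A B) {p q : Q} {x : Omega}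
    {M : Matrix R R Omega} (h : e = .mk p x q M) :
    x ≠ Omega.ninf ∧ x.bar = x ∧ barMat M = M := by
  suffices H : e = .bot ∨ ∃ p q x M, e = .mk p x q M ∧ x ≠ Omega.ninf ∧ x.bar = x ∧
      barMat M = M by
    rcases H with H | ⟨p, q, x, M, H, hx⟩
    · rw [H] at h; cases h
    · rw [H] at h; cases h; exact hx
  clear h
  induction he using Subsemigroup.closure_induction with
  | mem e he =>
    obtain ⟨a, p, q, h, rfl⟩ := he
    exact .inr ⟨p, q, _, _, rfl, by rwa [Ne, Omega.ofWeight_eq_ninf], Omega.bar_ofWeight _,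
      barMat_projMat _⟩
  | mul e f _ _ ihe ihf =>
    by_cases hb : e * f = .bot
    · exact .inl hb
    obtain ⟨p, q, s, x, y, M, N, rfl, rfl⟩ := PathElt.mul_ne_bot hb
    rcases ihe with ihe | ⟨_, _, _, _, ihe, h1, h2, h3⟩ <;> cases ihe
    rcases ihf with ihf | ⟨_, _, _, _, ihf, h1', h2', h3'⟩ <;> cases ihf
    refine .inr ⟨_, _, _, _, PathElt.mk_mul_mk .., ?_, ?_, ?_⟩
    · rw [Ne, Omega.add_eq_ninf]; tauto
    · rw [Omega.bar_add, h2, h2']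
    · rw [barMat_mpMul, h3, h3']

/-- A product of an element obtained by one stabilisation and `n` nested flattenings with elements
of the semigroup of paths. -/
def IsNestedProd (A : MaxPlusAutomaton α Q) (B : MaxPlusAutomaton α R) (n : ℕ)
    (g : PathElt Q R) : Prop :=
  ∃ h u v, IsNested A B n h ∧ u ∈ pathSemigroupOne A B ∧ v ∈ pathSemigroupOne A B ∧
    (g : WithOne (PathElt Q R)) = u * (h : WithOne (PathElt Q R)) * v

theorem pathSemigroupOne_mul {u v : WithOne (PathElt Q R)} (hu : u ∈ pathSemigroupOne A B)
    (hv : v ∈ pathSemigroupOne A B) : u * v ∈ pathSemigroupOne A B := by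
  rcases hu with rfl | ⟨e, he, rfl⟩
  · rwa [one_mul]
  · rcases hv with rfl | ⟨f, hf, rfl⟩
    · exact .inr ⟨e, he, mul_one _⟩
    · exact .inr ⟨e * f, mul_mem he hf, rfl⟩

theorem IsNestedProd.mul_right {n : ℕ} {g e : PathElt Q R} (hg : IsNestedProd A B n g)
    (he : e ∈ pathSemigroup A B) : IsNestedProd A B n (g * e) := by
  obtain ⟨h, u, v, hh, hu, hv, hg⟩ := hg
  exact ⟨h, u, v * e, hh, hu, pathSemigroupOne_mul hv (.inr ⟨e, he, rfl⟩), by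
    rw [WithOne.coe_mul, hg, mul_assoc]⟩

theorem IsNestedProd.mul_left {n : ℕ} {g e : PathElt Q R} (hg : IsNestedProd A B n g)
    (he : e ∈ pathSemigroup A B) : IsNestedProd A B n (e * g) := by
  obtain ⟨h, u, v, hh, hu, hv, hg⟩ := hg
  exact ⟨h, e * u, v, hh, pathSemigroupOne_mul (.inr ⟨e, he, rfl⟩) hu, hv, by
    rw [WithOne.coe_mul, hg]; simp only [mul_assoc]⟩

theorem IsNested.prod {n : ℕ} {g : PathElt Q R} (hg : IsNested A B n g) : IsNestedProd A B n g :=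
  ⟨g, 1, 1, hg, .inl rfl, .inl rfl, by simp⟩

theorem IsNestedProd.flat {n : ℕ} {g : PathElt Q R} (hg : IsNestedProd A B n g)
    (hi : g.IsPathIdem) : IsNestedProd A B (n + 1) g.flat := by
  obtain ⟨h, u, v, hh, hu, hv, hg⟩ := hg
  exact (IsNested.flat hh hu hv hg hi).prod

theorem isAsymptotic_of_mem {e : PathElt Q R} (he : e ∈ pathSemigroup A B) :
    IsAsymptotic A B e := by
  induction he using Subsemigroup.closure_induction with
  | mem e he => exact .letter he
  | mul e f _ _ ihe ihf => exact .mul ihe ihf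

theorem isAsymptotic_of_sandwich {g h : PathElt Q R} {u v : WithOne (PathElt Q R)}
    (hh : IsAsymptotic A B h) (hu : u ∈ pathSemigroupOne A B) (hv : v ∈ pathSemigroupOne A B)
    (hg : (g : WithOne (PathElt Q R)) = u * (h : WithOne (PathElt Q R)) * v) :
    IsAsymptotic A B g := by
  rcases hu with rfl | ⟨e, he, rfl⟩ <;> rcases hv with rfl | ⟨f, hf, rfl⟩ <;>
    simp only [one_mul, mul_one, ← WithOne.coe_mul, WithOne.coe_inj] at hg <;> subst hg
  · exact hh
  · exact .mul hh (isAsymptotic_of_mem hf)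
  · exact .mul (isAsymptotic_of_mem he) hh
  · exact .mul (.mul (isAsymptotic_of_mem he) hh) (isAsymptotic_of_mem hf)

theorem IsNested.isAsymptotic {n : ℕ} {h : PathElt Q R} (hh : IsNested A B n h) :
    IsAsymptotic A B h := by
  induction hh with
  | stab hg hi => exact .stab (isAsymptotic_of_mem hg) hi
  | flat _ hu hv he hi ih => exact .flat (isAsymptotic_of_sandwich ih hu hv he) hi

theorem IsNestedProd.isAsymptotic {n : ℕ} {g : PathElt Q R} (hg : IsNestedProd A B n g) :
    IsAsymptotic A B g := by
  obtain ⟨h, u, v, hh, hu, hv, hg⟩ := hg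
  exact isAsymptotic_of_sandwich hh.isAsymptotic hu hv hg

/-- Some element obtained by one stabilisation and `n` nested flattenings lies above `e`, has the
value `∞`, and is finite on the contributors `C`. -/
def HasLift (A : MaxPlusAutomaton α Q) (B : MaxPlusAutomaton α R) (n : ℕ) (e : PathElt Q R)
    (C : Set (R × R)) : Prop :=
  ∃ p q x M N, e = .mk p x q M ∧ IsNestedProd A B n (.mk p .inf q N) ∧ barMat N = M ∧
    ∀ z ∈ C, N z.1 z.2 ≠ Omega.inf

/-- As `f` has no entry `∞`, an `∞` of the product at `(i, j)` comes from an `∞` of the left factor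
at some `(i, k)` with `k` leading to `j`; if `(i, j)` is a contributor of the node, then `(i, k)` is
one of the left child. -/
theorem HasLift.mul_right {n : ℕ} {e f : PathElt Q R} {C : Set (R × R)}
    (hf : f ∈ pathSemigroup A B) (hb : e * f ≠ .bot)
    (h : HasLift A B n e (leftContrib e.mat f.mat C)) : HasLift A B n (e * f) C := by
  obtain ⟨p, q, s, x, y, M, P, rfl, rfl⟩ := PathElt.mul_ne_bot hb
  obtain ⟨_, _, _, _, N, he, hN, hbar, hC⟩ := h
  cases he
  obtain ⟨hy, -, hP⟩ := pathSemigroup_bar hf rfl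
  have hmul := hN.mul_right hf
  rw [PathElt.mk_mul_mk, Omega.add_eq_inf.2 (.inl ⟨rfl, hy⟩)] at hmul
  refine ⟨p, s, x + y, mpMul M P, mpMul N P, PathElt.mk_mul_mk .., hmul, ?_, ?_⟩
  · rw [barMat_mpMul, hbar, hP]
  · rintro ⟨i, j⟩ hz hinf
    obtain ⟨k, ⟨h1, h2⟩ | ⟨h1, h2⟩⟩ := mpMul_eq_inf.1 hinf
    · exact hC (i, k) ⟨j, hz, h2, ne_ninf_of_barMat_eq hbar (by simp [h1])⟩ h1
    · exact ne_inf_of_barMat_eq hP h2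

theorem HasLift.mul_left {n : ℕ} {e f : PathElt Q R} {C : Set (R × R)}
    (hf : f ∈ pathSemigroup A B) (hb : f * e ≠ .bot)
    (h : HasLift A B n e (rightContrib f.mat e.mat C)) : HasLift A B n (f * e) C := by
  obtain ⟨p, q, s, x, y, M, P, rfl, rfl⟩ := PathElt.mul_ne_bot hb
  obtain ⟨_, _, _, _, N, he, hN, hbar, hC⟩ := h
  cases he
  obtain ⟨hx, -, hM⟩ := pathSemigroup_bar hf rfl
  have hmul := hN.mul_left hf
  rw [PathElt.mk_mul_mk, Omega.add_eq_inf.2 (.inr ⟨hx, rfl⟩)] at hmul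
  refine ⟨p, s, x + y, mpMul M P, mpMul M N, PathElt.mk_mul_mk .., hmul, ?_, ?_⟩
  · rw [barMat_mpMul, hbar, hM]
  · rintro ⟨i, j⟩ hz hinf
    obtain ⟨k, ⟨h1, h2⟩ | ⟨h1, h2⟩⟩ := mpMul_eq_inf.1 hinf
    · exact ne_inf_of_barMat_eq hM h1
    · exact hC (k, j) ⟨i, hz, h1, ne_ninf_of_barMat_eq hbar (by simp [h2])⟩ h2

/-- An `∞` of the flattening at `(i, j)` comes from a cycle of three steps through some `k`, with
`k` between `i` and `j`, one step `(a, b)` of which is `∞`. Being on the cycle, `(a, b)` is a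
contributor of the middle children, where the lift is finite. -/
theorem HasLift.flat {n : ℕ} {e : PathElt Q R} {C : Set (R × R)} (hi : e * e = e)
    (hb : e ≠ .bot) (h : HasLift A B n e (middleContrib e.mat C)) : HasLift A B (n + 1) e C := by
  obtain ⟨p, x, M, rfl, hM⟩ := PathElt.idem_eq hi hb
  obtain ⟨_, _, _, _, N, he, hN, hbar, hC⟩ := h
  cases he
  have hidem : IsPathIdemMat N := by rw [IsPathIdemMat, hbar, hM]
  have hNM : ∀ {i j}, N i j ≠ Omega.ninf → M i j ≠ Omega.ninf := ne_ninf_of_barMat_eq hbar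
  refine ⟨p, p, x, M, flatMat N, rfl, hN.flat ⟨rfl, hidem⟩, by rw [barMat_flatMat hidem, hbar], ?_⟩
  rintro ⟨i, j⟩ hz hinf
  obtain ⟨k, hik, hkk, hkj⟩ := flatMat_eq_inf hinf
  have key : ∀ a b, N k a ≠ Omega.ninf → N b k ≠ Omega.ninf → N a b = Omega.inf → False :=
    fun a b hka hbk hab => by
      have hab' : N a b ≠ Omega.ninf := by simp [hab]
      have hka' := hidem.trans_ne_ninf hik hka
      have hbj := hidem.trans_ne_ninf hbk hkj
      have hba := hidem.trans_ne_ninf hbk hka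
      exact hC (a, b) ⟨i, j, hz, hNM hka', hNM hbj, hNM hab', hNM hba⟩ hab
  have hkk' : N k k ≠ Omega.ninf := by
    have h3 : mpMul (mpMul N N) N k k ≠ Omega.ninf := by simp [hkk]
    obtain ⟨b, h1, h2⟩ := mpMul_ne_ninf.1 h3
    obtain ⟨a, h1, h3⟩ := mpMul_ne_ninf.1 h1
    exact hidem.trans_ne_ninf h1 (hidem.trans_ne_ninf h3 h2)
  obtain ⟨b, ⟨h1, h2⟩ | ⟨h1, h2⟩⟩ := mpMul_eq_inf.1 hkk
  · obtain ⟨a, ⟨h3, h4⟩ | ⟨h3, h4⟩⟩ := mpMul_eq_inf.1 h1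
    · exact key k a hkk' (hidem.trans_ne_ninf h4 h2) h3
    · exact key a b h3 h2 h4
  · obtain ⟨a, h3, h4⟩ := mpMul_ne_ninf.1 h1
    exact key b k (hidem.trans_ne_ninf h3 h4) hkk' h2

/-- Stabilisation creates `∞` at `(i, j)` only through a diagonal entry `1` at some `k` between `i`
and `j`. When `(i, j)` is in `C`, the pair `(k, k)` is a middle contributor, where the entry is `0`.
-/
theorem hasLift_stab {e : PathElt Q R} {C : Set (R × R)} (he : e ∈ pathSemigroup A B)
    (hi : e * e = e) (hv : e.val = Omega.one)
    (h : ∀ z ∈ middleContrib e.mat C, e.mat z.1 z.2 = Omega.zero) : HasLift A B 0 e C := by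
  obtain ⟨p, x, M, rfl, hM⟩ := PathElt.idem_eq hi (by rintro rfl; cases hv)
  obtain ⟨-, -, hbar⟩ := pathSemigroup_bar he rfl
  have hidem : IsPathIdemMat M := by rw [IsPathIdemMat, hbar, hM]
  cases hv
  refine ⟨p, p, _, M, stabMat M, rfl, (IsNested.stab he ⟨rfl, hidem⟩).prod,
    by rw [barMat_stabMat hidem, hbar], ?_⟩
  rintro ⟨i, j⟩ hz hinf
  obtain ⟨k, hik, hkk, hkj⟩ := stabMat_eq_inf hbar hinf
  have hkk' : M k k ≠ Omega.ninf := by simp [hkk]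
  have := h (k, k) ⟨i, j, hz, hik, hkj, hkk', hkk'⟩
  simp [PathElt.mat, hkk] at this

theorem IsNode.isValid {t ν : FactTree (pathSemigroup A B)} {C : Set (R × R)} {b : Bool}
    (h : IsNode A B t ν C b) (ht : t.IsValid) (hb : t.label.1 ≠ .bot) :
    ν.IsValid ∧ ν.label.1 ≠ .bot := by
  induction h with
  | root => exact ⟨ht, hb⟩
  | prodLeft _ ih =>
    obtain ⟨⟨rfl, h1, h2⟩, h3⟩ := ih
    obtain ⟨_, _, _, _, _, _, _, h4, h5⟩ := PathElt.mul_ne_bot h3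
    exact ⟨h1, by simp [h4]⟩
  | prodRight _ ih =>
    obtain ⟨⟨rfl, h1, h2⟩, h3⟩ := ih
    obtain ⟨_, _, _, _, _, _, _, h4, h5⟩ := PathElt.mul_ne_bot h3
    exact ⟨h2, by simp [h5]⟩
  | idemLeft _ ih => exact ⟨(ih.1.2 _).2, by rw [(ih.1.2 _).1]; exact ih.2⟩
  | idemRight _ ih => exact ⟨(ih.1.2 _).2, by rw [(ih.1.2 _).1]; exact ih.2⟩
  | idemMiddle _ _ _ ih => exact ⟨(ih.1.2 _).2, by rw [(ih.1.2 _).1]; exact ih.2⟩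

theorem FactTree.height_child_lt {S : Type*} (e : S) (m : ℕ) (c : Fin (m + 3) → FactTree S)
    (i : Fin (m + 3)) : (c i).height + 1 ≤ (FactTree.idem e m c).height :=
  Nat.succ_le_succ (Finset.le_sup (f := fun i => (c i).height) (Finset.mem_univ i))

/-- Lifts propagate from a node to the root. -/
theorem IsNode.hasLift_root {t ν : FactTree (pathSemigroup A B)} {C : Set (R × R)} {b : Bool}
    (h : IsNode A B t ν C b) (ht : t.IsValid) (hb : t.label.1 ≠ .bot) :
    ∀ n, HasLift A B n ν.label.1 C → n + 1 ≤ ν.height →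
      ∃ n', HasLift A B n' t.label.1 (rootContrib B t.label.1.mat) ∧ n' + 1 ≤ t.height := by
  induction h with
  | root => exact fun n h1 h2 => ⟨n, h1, h2⟩
  | @prodLeft e l r C b h ih =>
    intro n h1 h2
    obtain ⟨⟨rfl, h3, h4⟩, h5⟩ := h.isValid ht hb
    refine ih n (h1.mul_right r.label.2 h5) (h2.trans ?_)
    simp only [FactTree.height]; omega
  | @prodRight e l r C b h ih =>
    intro n h1 h2
    obtain ⟨⟨rfl, h3, h4⟩, h5⟩ := h.isValid ht hb
    refine ih n (h1.mul_left l.label.2 h5) (h2.trans ?_)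
    simp only [FactTree.height]; omega
  | @idemLeft e m c C b h ih =>
    intro n h1 h2
    obtain ⟨⟨h3, h4⟩, h5⟩ := h.isValid ht hb
    have hee : e.1 * e.1 = e.1 := congrArg Subtype.val h3
    rw [(h4 _).1] at h1
    have h6 := h1.mul_right e.2 (by rw [hee]; exact h5)
    rw [hee] at h6
    exact ih n h6 (h2.trans ((Nat.le_succ _).trans (FactTree.height_child_lt e m c _)))
  | @idemRight e m c C b h ih =>
    intro n h1 h2
    obtain ⟨⟨h3, h4⟩, h5⟩ := h.isValid ht hb
    have hee : e.1 * e.1 = e.1 := congrArg Subtype.val h3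
    rw [(h4 _).1] at h1
    have h6 := h1.mul_left e.2 (by rw [hee]; exact h5)
    rw [hee] at h6
    exact ih n h6 (h2.trans ((Nat.le_succ _).trans (FactTree.height_child_lt e m c _)))
  | @idemMiddle e m c C b i h _ _ ih =>
    intro n h1 h2
    obtain ⟨⟨h3, h4⟩, h5⟩ := h.isValid ht hb
    have hee : e.1 * e.1 = e.1 := congrArg Subtype.val h3
    rw [(h4 _).1] at h1
    -- The only case that uses a flattening; the step up to the parent pays for it.
    exact ih (n + 1) (h1.flat hee h5)
      ((Nat.succ_le_succ h2).trans (FactTree.height_child_lt e m c _))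

/-- A fault and its idempotent parent have the same label, so the stabilisation is performed at the
parent, whose height is at least `1`. -/
theorem IsNode.exists_lift_of_fault {t ν : FactTree (pathSemigroup A B)} {C : Set (R × R)}
    (h : IsNode A B t ν C true) (ht : t.IsValid) (hb : t.label.1 ≠ .bot)
    (hv : ν.label.1.val = Omega.one) (hz : ∀ z ∈ C, ν.label.1.mat z.1 z.2 = Omega.zero) :
    ∃ n, HasLift A B n t.label.1 (rootContrib B t.label.1.mat) ∧ n + 1 ≤ t.height := by
  cases h with
  | @idemMiddle e m c C b i h h0 h1 =>
    obtain ⟨⟨h3, h4⟩, h5⟩ := h.isValid ht hb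
    rw [(h4 _).1] at hv hz
    refine h.hasLift_root ht hb 0 (hasLift_stab e.2 (congrArg Subtype.val h3) hv hz) ?_
    exact (Nat.succ_le_succ (Nat.zero_le _)).trans (FactTree.height_child_lt e m c i)

end Faults

/-! ### Matrices of words and weighted runs -/

theorem exists_nat_of_ne_bot {x : WithBot ℕ} (h : x ≠ ⊥) : ∃ n : ℕ, x = n := by
  obtain ⟨n, hn⟩ := WithBot.ne_bot_iff_exists.1 h
  exact ⟨n, hn.symm⟩

theorem withBot_add_finset_sup {ι : Type*} (s : Finset ι) (x : WithBot ℕ) (f : ι → WithBot ℕ) :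
    x + s.sup f = s.sup fun i => x + f i := by
  classical
  induction s using Finset.induction_on with
  | empty => simp
  | insert i s _ ih => simp only [Finset.sup_insert, ← ih]; exact (max_add_add_left _ _ _).symm

theorem withBot_finset_sup_add {ι : Type*} (s : Finset ι) (x : WithBot ℕ) (f : ι → WithBot ℕ) :
    s.sup f + x = s.sup fun i => f i + x := by
  simp only [add_comm _ x, withBot_add_finset_sup]

theorem withBot_mpMul_assoc {R : Type*} [Fintype R] (M N P : Matrix R R (WithBot ℕ)) :
    mpMul (mpMul M N) P = mpMul M (mpMul N P) := by
  funext i l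
  simp only [mpMul, withBot_finset_sup_add, withBot_add_finset_sup, add_assoc]
  rw [Finset.sup_comm]

theorem le_mpMul {R : Type*} [Fintype R] (M N : Matrix R R (WithBot ℕ)) (i j k : R) :
    M i j + N j k ≤ mpMul M N i k :=
  Finset.le_sup (f := fun j => M i j + N j k) (Finset.mem_univ j)

theorem exists_finset_sup_eq {ι : Type*} {s : Finset ι} {f : ι → WithBot ℕ} (h : s.sup f ≠ ⊥) :
    ∃ i ∈ s, s.sup f = f i := by
  rcases s.eq_empty_or_nonempty with rfl | hs
  · simp at h
  · exact Finset.exists_mem_eq_sup s hs f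

theorem exists_mpMul_eq {R : Type*} [Fintype R] {M N : Matrix R R (WithBot ℕ)} {i k : R}
    (h : mpMul M N i k ≠ ⊥) : ∃ j, mpMul M N i k = M i j + N j k := by
  obtain ⟨j, -, hj⟩ := exists_finset_sup_eq h
  exact ⟨j, hj⟩

theorem le_mpForm {Q : Type*} [Fintype Q] (I : Q → WithBot ℕ) (M : Matrix Q Q (WithBot ℕ))
    (F : Q → WithBot ℕ) (p q : Q) : I p + M p q + F q ≤ mpForm I M F :=
  (Finset.le_sup (f := fun q => I p + M p q + F q) (Finset.mem_univ q)).trans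
    (Finset.le_sup (f := fun p => Finset.univ.sup fun q => I p + M p q + F q) (Finset.mem_univ p))

theorem exists_mpForm_eq {Q : Type*} [Fintype Q] {I : Q → WithBot ℕ} {M : Matrix Q Q (WithBot ℕ)}
    {F : Q → WithBot ℕ} (h : mpForm I M F ≠ ⊥) : ∃ p q, mpForm I M F = I p + M p q + F q := by
  obtain ⟨p, -, hp⟩ := exists_finset_sup_eq h
  rw [mpForm, hp] at h
  obtain ⟨q, -, hq⟩ := exists_finset_sup_eq h
  exact ⟨p, q, hp.trans hq⟩

namespace Omega

theorem ofWeight_coe (n : ℕ) : ofWeight (n : WithBot ℕ) = if n = 0 then zero else one := by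
  simp [ofWeight]

theorem ofWeight_bot : ofWeight ⊥ = ninf := by simp [ofWeight]

theorem ofWeight_add (x y : WithBot ℕ) : ofWeight (x + y) = ofWeight x + ofWeight y := by
  cases x with
  | bot => rw [WithBot.bot_add, ofWeight_bot]; exact (bot_add _).symm
  | coe x =>
    cases y with
    | bot => rw [WithBot.add_bot, ofWeight_bot]; exact (add_bot _).symm
    | coe y =>
      have h := ofWeight_coe (x + y)
      push_cast at h
      change ofWeight ((x : WithBot ℕ) + (y : WithBot ℕ)) = ofWeight (x : WithBot ℕ) + ofWeight (y : WithBot ℕ)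
      rw [h, ofWeight_coe, ofWeight_coe]
      rcases Nat.eq_zero_or_pos x with rfl | hx <;> rcases Nat.eq_zero_or_pos y with rfl | hy
      · simp; decide
      · simp [hy.ne']; decide
      · simp [hx.ne']; decide
      · simp [hx.ne', hy.ne']; decide

theorem ofWeight_mono : Monotone ofWeight := by
  intro x y h
  cases x with
  | bot => rw [ofWeight_bot]; exact bot_le
  | coe x =>
    cases y with
    | bot => simp at h
    | coe y =>
      have h' : x ≤ y := WithBot.coe_le_coe.1 h
      change ofWeight (x : WithBot ℕ) ≤ ofWeight (y : WithBot ℕ)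
      rw [ofWeight_coe, ofWeight_coe]
      split_ifs <;> first | decide | omega

theorem ofWeight_finset_sup {ι : Type*} (s : Finset ι) (f : ι → WithBot ℕ) :
    ofWeight (s.sup f) = s.sup fun i => ofWeight (f i) := by
  classical
  induction s using Finset.induction_on with
  | empty => exact ofWeight_bot
  | insert i s _ ih =>
    rw [Finset.sup_insert, Finset.sup_insert, ← ih]
    exact ofWeight_mono.map_sup _ _

end Omega

theorem projMat_mpMul {R : Type*} [Fintype R] (M N : Matrix R R (WithBot ℕ)) :
    projMat (mpMul M N) = mpMul (projMat M) (projMat N) := by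
  funext i j
  simp only [projMat, mpMul, Omega.ofWeight_finset_sup, Omega.ofWeight_add]

theorem projMat_ne_ninf {R : Type*} {M : Matrix R R (WithBot ℕ)} {i j : R} :
    projMat M i j ≠ Omega.ninf ↔ ∃ b : ℕ, M i j = b := by
  rw [projMat, Ne, Omega.ofWeight_eq_ninf]
  exact ⟨exists_nat_of_ne_bot, fun ⟨b, h⟩ => by rw [h]; exact WithBot.coe_ne_bot⟩

namespace MaxPlusAutomaton

variable {α Q : Type*} [Fintype Q] (A : MaxPlusAutomaton α Q)

theorem wordMat_nil_mul (M : Matrix Q Q (WithBot ℕ)) : mpMul (A.wordMat []) M = M := by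
  classical
  funext i j
  apply le_antisymm
  · apply Finset.sup_le
    intro k _
    simp only [wordMat]
    split_ifs with h
    · subst h; simp
    · simp
  · refine le_trans ?_ (le_mpMul _ _ i i j)
    simp [wordMat]

theorem mul_wordMat_nil (M : Matrix Q Q (WithBot ℕ)) : mpMul M (A.wordMat []) = M := by
  classical
  funext i j
  apply le_antisymm
  · apply Finset.sup_le
    intro k _
    simp only [wordMat]
    split_ifs with h
    · subst h; simp
    · simp
  · refine le_trans ?_ (le_mpMul _ _ i j j)
    simp [wordMat]

theorem wordMat_append (u w : List α) :
    A.wordMat (u ++ w) = mpMul (A.wordMat u) (A.wordMat w) := by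
  induction u with
  | nil => rw [wordMat_nil_mul]; rfl
  | cons a u ih => rw [List.cons_append, wordMat, wordMat, ih, withBot_mpMul_assoc]

theorem wordMat_singleton (a : α) : A.wordMat [a] = A.M a := by
  rw [wordMat, mul_wordMat_nil]

theorem wordMat_append_le (u w : List α) (i j k : Q) :
    A.wordMat u i j + A.wordMat w j k ≤ A.wordMat (u ++ w) i k := by
  rw [wordMat_append]; exact le_mpMul _ _ _ _ _

end MaxPlusAutomaton

/-! ### Weighted runs of `A` and labels of trees -/

section Runs

variable {α Q R : Type*} {A : MaxPlusAutomaton α Q} {B : MaxPlusAutomaton α R}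

/-- `IsWeightedRun A B p w q L v`: there is a run of `A` from `p` to `q` labelled by `w`, of weight
`v`, and `L` is the list of the elements attached to its transitions. -/
inductive IsWeightedRun (A : MaxPlusAutomaton α Q) (B : MaxPlusAutomaton α R) :
    Q → List α → Q → List (PathElt Q R) → ℕ → Prop
  | nil (p : Q) : IsWeightedRun A B p [] p [] 0
  | cons {p q r : Q} {a : α} {w : List α} {L : List (PathElt Q R)} {x v : ℕ} :
      A.M a p q = x → IsWeightedRun A B q w r L v →
      IsWeightedRun A B p (a :: w) r (letterElt A B a p q :: L) (x + v)

theorem IsWeightedRun.isRun {p q : Q} {w : List α} {L : List (PathElt Q R)} {v : ℕ}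
    (h : IsWeightedRun A B p w q L v) : IsRun A B p w q L := by
  induction h with
  | nil p => exact .nil p
  | cons hx _ ih => exact .cons (by rw [hx]; exact WithBot.coe_ne_bot) ih

theorem IsRun.exists_weight {p q : Q} {w : List α} {L : List (PathElt Q R)}
    (h : IsRun A B p w q L) : ∃ v, IsWeightedRun A B p w q L v := by
  induction h with
  | nil p => exact ⟨0, .nil p⟩
  | cons hx _ ih =>
    obtain ⟨v, hv⟩ := ih
    obtain ⟨x, hx⟩ := exists_nat_of_ne_bot hx
    exact ⟨x + v, .cons hx hv⟩

theorem exists_weightedRun [Fintype Q] (B : MaxPlusAutomaton α R) (w : List α) (p q : Q)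
    (v : ℕ) (h : A.wordMat w p q = v) : ∃ L, IsWeightedRun A B p w q L v := by
  induction w generalizing p v with
  | nil =>
    simp only [MaxPlusAutomaton.wordMat] at h
    split_ifs at h with hpq
    · subst hpq
      obtain rfl : 0 = v := by exact_mod_cast h
      exact ⟨[], .nil p⟩
    · simp at h
  | cons a w ih =>
    rw [MaxPlusAutomaton.wordMat] at h
    obtain ⟨r, hr⟩ := exists_mpMul_eq (M := A.M a) (N := A.wordMat w) (i := p) (k := q)
      (by rw [h]; exact WithBot.coe_ne_bot)
    rw [h] at hr
    have h1 : A.M a p r ≠ ⊥ := fun h1 => by simp [h1] at hr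
    have h2 : A.wordMat w r q ≠ ⊥ := fun h2 => by simp [h2] at hr
    obtain ⟨x, hx⟩ := exists_nat_of_ne_bot h1
    obtain ⟨y, hy⟩ := exists_nat_of_ne_bot h2
    rw [hx, hy] at hr
    obtain rfl : v = x + y := by exact_mod_cast hr
    obtain ⟨L, hL⟩ := ih r y hy
    exact ⟨_, .cons hx hL⟩

theorem IsRun.mem_letterElts {p q : Q} {w : List α} {L : List (PathElt Q R)}
    (h : IsRun A B p w q L) : ∀ e ∈ L, e ∈ letterElts A B := by
  induction h with
  | nil p => simp
  | cons hx _ ih =>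
    intro e he
    rcases List.mem_cons.1 he with rfl | he
    · exact ⟨_, _, _, hx, rfl⟩
    · exact ih e he

theorem IsWeightedRun.split {p q : Q} {w : List α} {L₁ L₂ : List (PathElt Q R)} {v : ℕ}
    (h : IsWeightedRun A B p w q (L₁ ++ L₂) v) : ∃ w₁ w₂ r v₁ v₂, w = w₁ ++ w₂ ∧ v = v₁ + v₂ ∧
      IsWeightedRun A B p w₁ r L₁ v₁ ∧ IsWeightedRun A B r w₂ q L₂ v₂ := by
  induction L₁ generalizing p w v with
  | nil => exact ⟨[], w, p, 0, v, rfl, (Nat.zero_add v).symm, .nil p, h⟩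
  | cons e L₁ ih =>
    cases h with
    | cons hx h =>
      obtain ⟨w₁, w₂, r, v₁, v₂, rfl, rfl, h1, h2⟩ := ih h
      exact ⟨_ :: w₁, w₂, r, _, v₂, rfl, (Nat.add_assoc _ _ _).symm, .cons hx h1, h2⟩

theorem IsWeightedRun.split_range {n : ℕ} {L : ℕ → List (PathElt Q R)} {p q : Q} {w : List α}
    {v : ℕ} (h : IsWeightedRun A B p w q ((List.range n).map L).flatten v) :
    ∃ (W : ℕ → List α) (V : ℕ → ℕ), w = ((List.range n).map W).flatten ∧
      v = ∑ i ∈ Finset.range n, V i ∧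
      ∀ i < n, ∃ p q, IsWeightedRun A B p (W i) q (L i) (V i) := by
  induction n generalizing q w v with
  | zero =>
    cases h
    exact ⟨fun _ => [], fun _ => 0, by simp, by simp, by simp⟩
  | succ n ih =>
    rw [List.range_succ, List.map_append, List.flatten_append] at h
    obtain ⟨w₁, w₂, r, v₁, v₂, rfl, rfl, h1, h2⟩ := h.split
    obtain ⟨W, V, rfl, rfl, h3⟩ := ih h1
    have hW : ∀ i < n, Function.update W n w₂ i = W i := fun i hi =>
      Function.update_of_ne hi.ne _ _
    have hV : ∀ i < n, Function.update V n v₂ i = V i := fun i hi =>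
      Function.update_of_ne hi.ne _ _
    refine ⟨Function.update W n w₂, Function.update V n v₂, ?_, ?_, ?_⟩
    · rw [List.range_succ, List.map_append, List.flatten_append]
      congr 1
      · rw [List.map_congr_left]
        exact fun i hi => (hW i (List.mem_range.1 hi)).symm
      · simp
    · rw [Finset.sum_range_succ, Function.update_self]
      congr 1
      exact Finset.sum_congr rfl fun i hi => (hV i (Finset.mem_range.1 hi)).symm
    · intro i hi
      rcases Nat.lt_succ_iff_lt_or_eq.1 hi with hi | rfl
      · rw [hW i hi, hV i hi]; exact h3 i hi
      · rw [Function.update_self, Function.update_self]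
        exact ⟨r, q, by simpa using h2⟩

variable [Fintype R]

theorem IsWeightedRun.label_eq {L : List (pathSemigroup A B)} (hL : L ≠ []) {p q : Q}
    {w : List α} {v : ℕ} (h : IsWeightedRun A B p w q (L.map Subtype.val) v)
    {e : pathSemigroup A B} (he : (e : WithOne (pathSemigroup A B)) = listVal L) :
    e.1 = .mk p (Omega.ofWeight v) q (projMat (B.wordMat w)) := by
  induction L generalizing p w v e with
  | nil => exact absurd rfl hL
  | cons a L ih =>
    rw [List.map_cons] at h
    generalize ha : a.1 = a' at h
    cases h with
    | cons hx h =>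
      by_cases hL' : L = []
      · subst hL'
        cases h
        rw [listVal_singleton, WithOne.coe_inj] at he
        rw [he, ha, MaxPlusAutomaton.wordMat_singleton, letterElt, hx]
        rfl
      · obtain ⟨e', he'⟩ := WithOne.ne_one_iff_exists.1 (listVal_ne_one hL')
        have hee : e = a * e' := by
          rw [← WithOne.coe_inj, he, WithOne.coe_mul, he']
          simp [listVal]
        have h1 := ih hL' h he'
        rw [hee]
        change a.1 * e'.1 = _
        rw [h1, ha, letterElt, PathElt.mk_mul_mk, MaxPlusAutomaton.wordMat, projMat_mpMul, hx,
          ← Omega.ofWeight_add]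
        rfl

theorem FactTree.leaves_ne_nil {S : Type*} (t : FactTree S) : t.leaves ≠ [] := by
  induction t with
  | leaf e => simp [FactTree.leaves]
  | prod e l r ihl ihr => simp [FactTree.leaves, ihl]
  | idem e m c ih => simp [FactTree.leaves, ih]

theorem IsWeightedRun.tree_label_eq {t : FactTree (pathSemigroup A B)} (ht : t.IsValid) {p q : Q}
    {w : List α} {v : ℕ} (h : IsWeightedRun A B p w q (t.leaves.map Subtype.val) v) :
    t.label.1 = .mk p (Omega.ofWeight v) q (projMat (B.wordMat w)) :=
  h.label_eq t.leaves_ne_nil ht.label_eq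

/-- A factorisation tree with a fault gives a tractable witness. -/
theorem exists_tractableWitness_of_fault {w : List α}
    {t : FactTree (pathSemigroup A B)} (ht : IsFactTreeOn A B w t)
    (hh : t.height ≤ 3 * Nat.card (pathSemigroup A B)) (hf : HasFault A B t) :
    ∃ g, IsTractableWitness A B g := by
  obtain ⟨hv, p, q, hp, hq, hr⟩ := ht
  obtain ⟨v, hr⟩ := hr.exists_weight
  have hlab := hr.tree_label_eq hv
  obtain ⟨ν, C, hν, h1, h2⟩ := hf
  obtain ⟨n, ⟨_, _, _, M, N, he, hN, hbar, hC⟩, hn⟩ :=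
    hν.exists_lift_of_fault hv (by rw [hlab]; simp) h1 h2
  have hM : t.label.1.mat = M := by rw [he]; rfl
  rw [hlab] at he
  cases he
  refine ⟨_, ⟨hN.isAsymptotic, p, q, N, rfl, hp, hq, ?_⟩, ?_⟩
  · rw [Omega.lt_inf]
    intro hinf
    obtain ⟨i, -, hi⟩ := Omega.finset_sup_eq_inf.1 hinf
    obtain ⟨j, -, hij⟩ := Omega.finset_sup_eq_inf.1 hi
    have hne : ∀ x, Omega.ofWeight x ≠ Omega.inf := fun x hx => by
      rw [← Omega.bar_ofWeight] at hx; exact Omega.bar_ne_inf _ hx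
    rcases Omega.add_eq_inf.1 hij with ⟨h3, h4⟩ | ⟨-, h4⟩
    · rcases Omega.add_eq_inf.1 h3 with ⟨h5, -⟩ | ⟨h5, h6⟩
      · exact hne _ h5
      · refine hC (i, j) ⟨?_, ?_, ?_⟩ h6
        · rwa [Ne, ← Omega.ofWeight_eq_ninf]
        · rwa [Ne, ← Omega.ofWeight_eq_ninf]
        · rw [hM]; exact ne_ninf_of_barMat_eq hbar (by simp [h6])
    · exact hne _ h4
  · obtain ⟨h, u, v, h3, h4, h5, h6⟩ := hN
    exact ⟨n, h, u, v, hn.trans hh, h3, h4, h5, h6⟩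

end Runs

/-! ### Factorisation trees without faults -/

section Bound

variable {α Q R : Type*} [Fintype R] {A : MaxPlusAutomaton α Q} {B : MaxPlusAutomaton α R}

theorem add_le_wordMat_append {u w : List α} {i j k : R} {x y : ℕ}
    (h : (x : WithBot ℕ) ≤ B.wordMat u i j) (h' : (y : WithBot ℕ) ≤ B.wordMat w j k) :
    ((x + y : ℕ) : WithBot ℕ) ≤ B.wordMat (u ++ w) i k := by
  push_cast
  exact (add_le_add h h').trans (B.wordMat_append_le _ _ _ _ _)

theorem zero_le_of_projMat {M : Matrix R R Omega} {w : List α} {i j : R}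
    (h : projMat (B.wordMat w) = M) (hij : M i j ≠ Omega.ninf) :
    ((0 : ℕ) : WithBot ℕ) ≤ B.wordMat w i j := by
  rw [← h] at hij
  obtain ⟨b, hb⟩ := projMat_ne_ninf.1 hij
  rw [hb]
  exact_mod_cast Nat.zero_le b

/-- A run which follows a loop through `l` and `k` collects the weights of pairwise nonadjacent
blocks. -/
theorem sum_le_wordMat_of_loop {W : ℕ → List α} {M : Matrix R R Omega} {N : ℕ}
    (hMM : mpMul M M = M) (hW : ∀ i ≤ N, projMat (B.wordMat (W i)) = M) {T : ℕ → Prop}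
    [DecidablePred T] (hT : ∀ i, T i → ¬ T (i + 1)) (hT0 : ¬ T 0) (hTN : ¬ T N) {b : ℕ → ℕ}
    {i l k j : R} (hb : ∀ n, T n → (b n : WithBot ℕ) ≤ B.wordMat (W n) l k)
    (hil : M i l ≠ Omega.ninf) (hlk : M l k ≠ Omega.ninf) (hkl : M k l ≠ Omega.ninf)
    (hkj : M k j ≠ Omega.ninf) (hN : 0 < N) :
    ((∑ n ∈ Finset.range (N + 1), if T n then b n else 0 : ℕ) : WithBot ℕ) ≤
      B.wordMat ((List.range (N + 1)).map W).flatten i j := by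
  have htrans : ∀ {a b c}, M a b ≠ Omega.ninf → M b c ≠ Omega.ninf → M a c ≠ Omega.ninf :=
    fun {a b c} h1 h2 => by rw [← hMM]; exact mpMul_ne_ninf.2 ⟨b, h1, h2⟩
  have hsplit : ∀ n, ((List.range (n + 1)).map W).flatten =
      ((List.range n).map W).flatten ++ W n := fun n => by simp [List.range_succ]
  -- The run of `B` is in `k` after a block of `T` and in `l` after any other block. Since `T` has
  -- no two consecutive indices, the run is back in `l` before each block of `T`, where it collects
  -- `b n`.
  have key : ∀ n < N,
      (T n → ((∑ n ∈ Finset.range (n + 1), if T n then b n else 0 : ℕ) : WithBot ℕ) ≤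
        B.wordMat ((List.range (n + 1)).map W).flatten i k) ∧
      (¬ T n → ((∑ n ∈ Finset.range (n + 1), if T n then b n else 0 : ℕ) : WithBot ℕ) ≤
        B.wordMat ((List.range (n + 1)).map W).flatten i l) := by
    intro n
    induction n with
    | zero =>
      intro h
      refine ⟨fun h0 => absurd h0 hT0, fun _ => ?_⟩
      simpa [hT0] using zero_le_of_projMat (hW 0 h.le) hil
    | succ n ih =>
      intro h
      obtain ⟨ih1, ih2⟩ := ih (by omega)
      rw [Finset.sum_range_succ, hsplit]
      constructor
      · intro hn
        rw [if_pos hn]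
        exact add_le_wordMat_append (ih2 fun h' => hT n h' hn) (hb _ hn)
      · intro hn
        rw [if_neg hn]
        by_cases hn' : T n
        · exact add_le_wordMat_append (ih1 hn') (zero_le_of_projMat (hW _ h.le) hkl)
        · exact add_le_wordMat_append (ih2 hn')
            (zero_le_of_projMat (hW _ h.le) (htrans hlk hkl))
  obtain ⟨n, rfl⟩ := Nat.exists_eq_succ_of_ne_zero hN.ne'
  obtain ⟨h1, h2⟩ := key n (Nat.lt_succ_self n)
  rw [Finset.sum_range_succ, hsplit, if_neg hTN]
  by_cases hn' : T n
  · exact add_le_wordMat_append (h1 hn') (zero_le_of_projMat (hW _ le_rfl) hkj)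
  · exact add_le_wordMat_append (h2 hn') (zero_le_of_projMat (hW _ le_rfl) (htrans hlk hkj))

theorem exists_sum_le_card_mul {κ : Type*} [Fintype κ] [Nonempty κ] [DecidableEq κ]
    (s : Finset ℕ) (f : ℕ → κ) (b : ℕ → ℕ) :
    ∃ k, ∑ i ∈ s, b i ≤ Fintype.card κ * ∑ i ∈ s with f i = k, b i := by
  obtain ⟨k, -, hk⟩ := Finset.exists_max_image Finset.univ
    (fun k => ∑ i ∈ s with f i = k, b i) Finset.univ_nonempty
  refine ⟨k, ?_⟩
  rw [← Finset.sum_fiberwise s f b]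
  simpa using Finset.sum_le_card_nsmul Finset.univ _ _ hk

theorem IsNode.contrib_ne_ninf {t ν : FactTree (pathSemigroup A B)} {C : Set (R × R)} {b : Bool}
    (h : IsNode A B t ν C b) (ht : t.IsValid) (hb : t.label.1 ≠ .bot) :
    ∀ z ∈ C, ν.label.1.mat z.1 z.2 ≠ Omega.ninf := by
  cases h with
  | root => exact fun z hz => hz.2.2
  | prodLeft h => rintro z ⟨j, -, -, h⟩; exact h
  | prodRight h => rintro z ⟨j, -, -, h⟩; exact h
  | idemLeft h =>
    rintro z ⟨j, -, -, h'⟩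
    rwa [((h.isValid ht hb).1.2 _).1]
  | idemRight h =>
    rintro z ⟨j, -, -, h'⟩
    rwa [((h.isValid ht hb).1.2 _).1]
  | idemMiddle h =>
    rintro z ⟨_, _, -, -, -, h', -⟩
    rwa [((h.isValid ht hb).1.2 _).1]

/-- The weight of the run below a node is at most `c` times some contributing entry, plus `c`. -/
def IsBounded (B : MaxPlusAutomaton α R) (c : ℕ) (w : List α) (C : Set (R × R)) (v : ℕ) : Prop :=
  ∃ z ∈ C, ∃ b : ℕ, (b : WithBot ℕ) ≤ B.wordMat w z.1 z.2 ∧ v ≤ c * b + c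

/-- Either bound extends to the whole word by a run of nonnegative weight on the other half; the
larger of the two entries pays for both halves. -/
theorem IsBounded.prod {c : ℕ} {w₁ w₂ : List α} {C : Set (R × R)} {v₁ v₂ : ℕ}
    {M P : Matrix R R Omega} (hM : projMat (B.wordMat w₁) = M) (hP : projMat (B.wordMat w₂) = P)
    (h₁ : IsBounded B c w₁ (leftContrib M P C) v₁)
    (h₂ : IsBounded B c w₂ (rightContrib M P C) v₂) :
    IsBounded B (2 * c) (w₁ ++ w₂) C (v₁ + v₂) := by
  obtain ⟨z₁, ⟨j, hz₁, hj, -⟩, b₁, hb₁, hv₁⟩ := h₁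
  obtain ⟨z₂, ⟨i, hz₂, hi, -⟩, b₂, hb₂, hv₂⟩ := h₂
  have h1 := add_le_wordMat_append hb₁ (zero_le_of_projMat hP hj)
  have h2 := add_le_wordMat_append (zero_le_of_projMat hM hi) hb₂
  rw [add_zero] at h1
  rw [zero_add] at h2
  rcases le_total b₁ b₂ with hb | hb
  · exact ⟨_, hz₂, b₂, h2, by nlinarith [Nat.mul_le_mul_left c hb]⟩
  · exact ⟨_, hz₁, b₁, h1, by nlinarith [Nat.mul_le_mul_left c hb]⟩

theorem projMat_wordMat_flatten {W : ℕ → List α} {M : Matrix R R Omega} (hMM : mpMul M M = M)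
    {N : ℕ} (hW : ∀ i ≤ N, projMat (B.wordMat (W i)) = M) :
    projMat (B.wordMat ((List.range (N + 1)).map W).flatten) = M := by
  induction N with
  | zero => simpa using hW 0 le_rfl
  | succ N ih =>
    rw [List.range_succ, List.map_append, List.flatten_append, MaxPlusAutomaton.wordMat_append,
      projMat_mpMul, ih fun i hi => hW i (by omega)]
    simpa [hW _ le_rfl] using hMM

/-- The bound for an idempotent node. -/
theorem IsBounded.idem {c N : ℕ} {W : ℕ → List α} {V : ℕ → ℕ} {C : Set (R × R)}
    {M : Matrix R R Omega} (hMM : mpMul M M = M) (hN : 0 < N)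
    (hW : ∀ i ≤ N, projMat (B.wordMat (W i)) = M)
    (hl : IsBounded B c (W 0) (leftContrib M M C) (V 0))
    (hr : IsBounded B c (W N) (rightContrib M M C) (V N))
    (hm : ∀ i, 0 < i → i < N → ∃ z : R × R, ∃ b : ℕ, V i ≤ 2 * c * b ∧
      (0 < b → z ∈ middleContrib M C) ∧
      (z ∈ middleContrib M C → (b : WithBot ℕ) ≤ B.wordMat (W i) z.1 z.2)) :
    IsBounded B ((4 * Fintype.card (R × R) + 2) * c) ((List.range (N + 1)).map W).flatten C
      (∑ i ∈ Finset.range (N + 1), V i) := by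
  classical
  set D := Fintype.card (R × R) with hD
  obtain ⟨⟨i₁, l₁⟩, ⟨j₁, hz₁, hj₁, -⟩, b₁, hb₁, hv₁⟩ := hl
  obtain ⟨⟨k₂, j₂⟩, ⟨i₂, hz₂, hi₂, -⟩, b₂, hb₂, hv₂⟩ := hr
  simp only at hz₁ hj₁ hb₁ hz₂ hi₂ hb₂
  have hm' : ∀ i, ∃ z : R × R, ∃ b : ℕ, 0 < i → i < N → V i ≤ 2 * c * b ∧
      (0 < b → z ∈ middleContrib M C) ∧
      (z ∈ middleContrib M C → (b : WithBot ℕ) ≤ B.wordMat (W i) z.1 z.2) := by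
    intro i
    by_cases hi : 0 < i ∧ i < N
    · obtain ⟨z, b, h⟩ := hm i hi.1 hi.2
      exact ⟨z, b, fun _ _ => h⟩
    · exact ⟨(i₁, i₁), 0, fun h1 h2 => absurd ⟨h1, h2⟩ hi⟩
  choose f b hfb using hm'
  obtain ⟨n, rfl⟩ := Nat.exists_eq_succ_of_ne_zero hN.ne'
  have hW₁ : ((b₁ : ℕ) : WithBot ℕ) ≤
      B.wordMat ((List.range (n + 1 + 1)).map W).flatten i₁ j₁ := by
    have hrest : projMat (B.wordMat ((List.range (n + 1)).map (W ∘ Nat.succ)).flatten) = M :=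
      projMat_wordMat_flatten hMM fun i hi => hW _ (by omega)
    rw [List.range_succ_eq_map, List.map_cons, List.flatten_cons, List.map_map]
    exact add_le_wordMat_append hb₁ (zero_le_of_projMat hrest hj₁)
  have hW₂ : ((b₂ : ℕ) : WithBot ℕ) ≤
      B.wordMat ((List.range (n + 1 + 1)).map W).flatten i₂ j₂ := by
    have hrest : projMat (B.wordMat ((List.range (n + 1)).map W).flatten) = M :=
      projMat_wordMat_flatten hMM fun i hi => hW _ (by omega)
    rw [List.range_succ, List.map_append, List.flatten_append]
    have := add_le_wordMat_append (zero_le_of_projMat hrest hi₂) hb₂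
    rw [zero_add] at this
    simpa using this
  have : Nonempty (R × R) := ⟨(i₁, i₁)⟩
  -- Middle blocks are classified by contributor and by parity of the index, `2D` classes in all;
  -- the heaviest class carries a `1/(2D)` share. Fixing the parity makes the blocks pairwise
  -- nonadjacent.
  obtain ⟨⟨z, par⟩, hk⟩ := exists_sum_le_card_mul (Finset.Ioo 0 (n + 1))
    (fun i => (f i, decide (Even i))) b
  set T : ℕ → Prop := fun i => (0 < i ∧ i < n + 1) ∧ (f i, decide (Even i)) = (z, par) with hTdef
  set s := ∑ i ∈ Finset.range (n + 1 + 1), if T i then b i else 0 with hs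
  have hfs : (∑ i ∈ Finset.Ioo 0 (n + 1) with (f i, decide (Even i)) = (z, par), b i) = s := by
    rw [hs, ← Finset.sum_filter]
    apply Finset.sum_congr _ fun _ _ => rfl
    ext i
    simp only [Finset.mem_filter, Finset.mem_Ioo, Finset.mem_range, hTdef]
    constructor
    · rintro ⟨h1, h2⟩; exact ⟨by omega, h1, h2⟩
    · rintro ⟨-, h1, h2⟩; exact ⟨h1, h2⟩
  rw [hfs, Fintype.card_prod, Fintype.card_bool, ← hD] at hk
  have hmid : ∑ i ∈ Finset.Ioo 0 (n + 1), V i ≤ 4 * D * c * s := by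
    calc ∑ i ∈ Finset.Ioo 0 (n + 1), V i ≤ ∑ i ∈ Finset.Ioo 0 (n + 1), 2 * c * b i :=
          Finset.sum_le_sum fun i hi => (hfb i (Finset.mem_Ioo.1 hi).1 (Finset.mem_Ioo.1 hi).2).1
      _ = 2 * c * ∑ i ∈ Finset.Ioo 0 (n + 1), b i := by rw [Finset.mul_sum]
      _ ≤ 2 * c * (D * 2 * s) := Nat.mul_le_mul_left _ hk
      _ = 4 * D * c * s := by ring
  have htot : ∑ i ∈ Finset.range (n + 1 + 1), V i =
      V 0 + ∑ i ∈ Finset.Ioo 0 (n + 1), V i + V (n + 1) := by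
    rw [Finset.sum_range_succ, show Finset.range (n + 1) = insert 0 (Finset.Ioo 0 (n + 1)) by
      ext i; simp only [Finset.mem_range, Finset.mem_insert, Finset.mem_Ioo]; omega,
      Finset.sum_insert (by simp)]
  have hsz : ∃ z ∈ C, (s : WithBot ℕ) ≤
      B.wordMat ((List.range (n + 1 + 1)).map W).flatten z.1 z.2 := by
    rcases Nat.eq_zero_or_pos s with h0 | h0
    · refine ⟨_, hz₁, le_trans ?_ hW₁⟩
      rw [h0]; exact_mod_cast Nat.zero_le _
    · obtain ⟨i, -, hi⟩ := Finset.exists_ne_zero_of_sum_ne_zero h0.ne'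
      have hTi : T i := by by_contra h; exact hi (if_neg h)
      rw [if_pos hTi] at hi
      have hfT : ∀ i, T i → f i = z := fun i h => (Prod.mk.inj h.2).1
      have hz : z ∈ middleContrib M C :=
        hfT i hTi ▸ (hfb i hTi.1.1 hTi.1.2).2.1 (Nat.pos_of_ne_zero hi)
      obtain ⟨i₀, j₀, hC, h1, h2, h3, h4⟩ := id hz
      refine ⟨_, hC, ?_⟩
      refine sum_le_wordMat_of_loop hMM hW (T := T) ?_ (fun h => absurd h.1.1 (lt_irrefl _))
        (fun h => absurd h.1.2 (lt_irrefl _)) ?_ h1 h3 h4 h2 hN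
      · intro i h h'
        have e1 := (Prod.mk.inj h.2).2
        have e2 := (Prod.mk.inj h'.2).2
        rw [← e2, decide_eq_decide, Nat.even_add_one] at e1
        tauto
      · intro i h
        have := (hfb i h.1.1 h.1.2).2.2
        rw [hfT i h] at this
        exact this hz
  obtain ⟨z₀, hz₀, hs₀⟩ := hsz
  have hmax : ∃ z ∈ C, ∃ β : ℕ, (β : WithBot ℕ) ≤
      B.wordMat ((List.range (n + 1 + 1)).map W).flatten z.1 z.2 ∧ s ≤ β ∧ b₁ ≤ β ∧ b₂ ≤ β := by
    rcases le_total b₁ b₂ with h | h <;> rcases le_total s (max b₁ b₂) with h' | h'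
    · exact ⟨_, hz₂, b₂, hW₂, by omega, h, le_rfl⟩
    · exact ⟨_, hz₀, s, hs₀, le_rfl, by omega, by omega⟩
    · exact ⟨_, hz₁, b₁, hW₁, by omega, le_rfl, h⟩
    · exact ⟨_, hz₀, s, hs₀, le_rfl, by omega, by omega⟩
  obtain ⟨z, hz, β, hβ, h1, h2, h3⟩ := hmax
  refine ⟨z, hz, β, hβ, ?_⟩
  have e1 := Nat.mul_le_mul_left c h2
  have e2 := Nat.mul_le_mul_left c h3
  have e3 := Nat.mul_le_mul_left (4 * D * c) h1
  rw [htot]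
  -- Of the factor `4D + 2`, the part `4D` is the `2D` classes times the `2` in `2 * c * b`, and the
  -- part `2` is the two extreme children.
  calc V 0 + ∑ i ∈ Finset.Ioo 0 (n + 1), V i + V (n + 1)
      ≤ (c * β + c) + 4 * D * c * β + (c * β + c) := by
        refine Nat.add_le_add (Nat.add_le_add ?_ (hmid.trans e3)) ?_
        · omega
        · exact hv₂.trans (by omega)
    _ ≤ (4 * D + 2) * c * β + (4 * D + 2) * c := by nlinarith [Nat.zero_le (D * c)]

/-- Without faults, the weight of the run below a node is bounded by the contributing entries. -/
theorem IsNode.isBounded {t : FactTree (pathSemigroup A B)} (ht : t.IsValid)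
    (hb : t.label.1 ≠ .bot) (hf : ¬ HasFault A B t) {K : ℕ}
    (hK : ∀ a p q, A.M a p q ≤ (K : WithBot ℕ)) (ν : FactTree (pathSemigroup A B)) :
    ∀ {C : Set (R × R)} {b : Bool} {p q : Q} {w : List α} {v h : ℕ}, IsNode A B t ν C b →
      IsWeightedRun A B p w q (ν.leaves.map Subtype.val) v → C.Nonempty → ν.height ≤ h →
      IsBounded B ((4 * Fintype.card (R × R) + 2) ^ h * K) w C v := by
  have hbase : ∀ h, K ≤ (4 * Fintype.card (R × R) + 2) ^ h * K := fun h =>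
    Nat.le_mul_of_pos_left _ (by positivity)
  induction ν with
  | leaf e =>
    intro C b p q w v h hν hr hC hh
    obtain ⟨z, hz⟩ := hC
    have hsupp := hν.contrib_ne_ninf ht hb z hz
    have hlab := hr.tree_label_eq (t := .leaf e) trivial
    rw [hlab] at hsupp
    refine ⟨z, hz, 0, zero_le_of_projMat rfl hsupp, ?_⟩
    simp only [FactTree.leaves, List.map_cons, List.map_nil] at hr
    generalize e.1 = e' at hr
    cases hr with
    | @cons _ _ _ _ _ _ x _ hx hr =>
      cases hr
      have hxK : x ≤ K := by
        have := hx.symm.trans_le (hK _ _ _)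
        exact_mod_cast this
      have := hbase h
      omega
  | prod e l r ihl ihr =>
    intro C b p q w v h hν hr hC hh
    have hval := (hν.isValid ht hb).1
    obtain ⟨z, hz⟩ := hC
    have hsupp := hν.contrib_ne_ninf ht hb z hz
    have hheight : max l.height r.height + 1 ≤ h := hh
    obtain ⟨h, rfl⟩ : ∃ h', h = h' + 1 := ⟨h - 1, by omega⟩
    simp only [FactTree.leaves, List.map_append] at hr
    obtain ⟨w₁, w₂, s, v₁, v₂, rfl, rfl, h1, h2⟩ := hr.split
    have hl1 := h1.tree_label_eq hval.2.1
    have hl2 := h2.tree_label_eq hval.2.2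
    have hlab : e.1 = l.label.1 * r.label.1 := congrArg Subtype.val hval.1
    change e.1.mat _ _ ≠ _ at hsupp
    rw [hlab, hl1, hl2, PathElt.mk_mul_mk] at hsupp
    obtain ⟨k, hk1, hk2⟩ := mpMul_ne_ninf.1 hsupp
    have hm1 : projMat (B.wordMat w₁) = l.label.1.mat := by rw [hl1]; rfl
    have hm2 : projMat (B.wordMat w₂) = r.label.1.mat := by rw [hl2]; rfl
    rw [hm1] at hk1
    rw [hm2] at hk2
    obtain ⟨z', hz', b', hb', hv'⟩ := IsBounded.prod hm1 hm2
      (ihl (h := h) (.prodLeft hν) h1 ⟨(z.1, k), z.2, hz, hk2, hk1⟩ (by omega))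
      (ihr (h := h) (.prodRight hν) h2 ⟨(k, z.2), z.1, hz, hk1, hk2⟩ (by omega))
    refine ⟨z', hz', b', hb', hv'.trans ?_⟩
    have : 2 * ((4 * Fintype.card (R × R) + 2) ^ h * K) ≤
        (4 * Fintype.card (R × R) + 2) ^ (h + 1) * K := by
      rw [pow_succ', mul_assoc]; exact Nat.mul_le_mul_right _ (by omega)
    exact Nat.add_le_add (Nat.mul_le_mul_right _ this) this
  | idem e m c ih =>
    intro C b p q w v h hν hr hC hh
    obtain ⟨⟨hee, hc⟩, hbot⟩ := hν.isValid ht hb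
    obtain ⟨z, hz⟩ := hC
    have hsupp : e.1.mat z.1 z.2 ≠ Omega.ninf := hν.contrib_ne_ninf ht hb z hz
    obtain ⟨h, rfl⟩ : ∃ h', h = h' + 1 :=
      ⟨h - 1, by have := FactTree.height_child_lt e m c 0; omega⟩
    have hch : ∀ i, (c i).height ≤ h := fun i => by
      have := FactTree.height_child_lt e m c i; omega
    obtain ⟨pe, xe, M, he, hMM⟩ := PathElt.idem_eq (congrArg Subtype.val hee) hbot
    have heM : e.1.mat = M := by rw [he]; rfl
    rw [heM] at hsupp
    -- `split_range` takes lists indexed by `ℕ`; indices outside the range get the empty list.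
    have hleaves : (FactTree.idem e m c).leaves.map Subtype.val =
        ((List.range (m + 2 + 1)).map fun i => if hi : i < m + 3 then
          (c ⟨i, hi⟩).leaves.map Subtype.val else []).flatten := by
      rw [FactTree.leaves, List.map_flatten]
      congr 1
      apply List.ext_getElem
      · simp
      · intro i h1 h2
        have hi : i < m + 3 := by
          rw [List.length_map, List.length_range] at h2; exact h2
        rw [List.getElem_map, List.getElem_ofFn, List.getElem_map, List.getElem_range, dif_pos hi]
    rw [hleaves] at hr
    obtain ⟨W, V, rfl, rfl, hWV⟩ := hr.split_range
    have hrun : ∀ i : Fin (m + 3), ∃ p q, IsWeightedRun A B p (W i) q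
        ((c i).leaves.map Subtype.val) (V i) := fun i => by
      have := hWV i i.2
      simpa using this
    have hlab : ∀ i : Fin (m + 3), ∃ p q, e.1 =
        .mk p (Omega.ofWeight (V i)) q (projMat (B.wordMat (W i))) := fun i => by
      obtain ⟨p, q, h⟩ := hrun i
      have := h.tree_label_eq (hc i).2
      rw [(hc i).1] at this
      exact ⟨p, q, this⟩
    have hproj : ∀ i : Fin (m + 3), projMat (B.wordMat (W i)) = M := fun i => by
      obtain ⟨p, q, h⟩ := hlab i
      rw [he] at h
      exact (PathElt.mk.inj h).2.2.2.symm
    obtain ⟨k, hk1, hk2⟩ := mpMul_ne_ninf.1 (hMM.symm ▸ hsupp)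
    rw [pow_succ', mul_assoc]
    refine IsBounded.idem hMM (Nat.succ_pos _) (fun i hi => hproj ⟨i, by omega⟩) ?_ ?_ ?_
    · obtain ⟨p', q', h1⟩ := hrun 0
      have := ih 0 (h := h) (.idemLeft hν) h1 (by
        rw [heM]; exact ⟨(z.1, k), z.2, hz, hk2, hk1⟩) (hch 0)
      rwa [heM] at this
    · obtain ⟨p', q', h1⟩ := hrun (Fin.last (m + 2))
      have := ih (Fin.last (m + 2)) (h := h) (.idemRight hν) h1 (by
        rw [heM]; exact ⟨(k, z.2), z.1, hz, hk1, hk2⟩) (hch _)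
      rwa [heM] at this
    · intro i hi0 hiN
      set i' : Fin (m + 3) := ⟨i, by omega⟩ with hi'
      have hnode := IsNode.idemMiddle (i := i') hν (by
        intro h0; rw [hi', Fin.ext_iff] at h0; simp at h0; omega) (by
        intro h0; rw [hi', Fin.ext_iff] at h0; simp at h0; omega)
      rw [heM] at hnode
      have hge : ∀ z ∈ middleContrib M C, ((0 : ℕ) : WithBot ℕ) ≤ B.wordMat (W i) z.1 z.2 := by
        rintro z ⟨_, _, -, -, -, h1, -⟩
        exact zero_le_of_projMat (hproj i') h1
      rcases Nat.eq_zero_or_pos (V i) with hV | hV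
      -- With `b = 0` the pair need not be a contributor, so any `z` serves.
      · exact ⟨z, 0, by omega, fun h => absurd h (lt_irrefl _), hge z⟩
      obtain ⟨p', q', hl⟩ := hlab i'
      have hone : (c i').label.1.val = Omega.one := by
        rw [(hc i').1, hl]
        change Omega.ofWeight (V i) = _
        rw [Omega.ofWeight_coe, if_neg hV.ne']
      -- As this child is not a fault, one of its contributors has a nonzero entry, of weight `b₂ ≥
      -- 1`. With the larger of `b₁` and `b₂`, the bound `c' * b + c'` becomes `2 * c' * b`, free of
      -- additive constants and thus summable over all middle children.
      obtain ⟨z₂, hz₂, hne⟩ : ∃ z ∈ middleContrib M C, M z.1 z.2 ≠ Omega.zero := by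
        by_contra! hcon
        refine hf ⟨_, _, hnode, hone, fun z hz => ?_⟩
        rw [(hc i').1, heM]
        exact hcon z hz
      have hb₂ : ∃ b₂ : ℕ, B.wordMat (W i) z₂.1 z₂.2 = b₂ ∧ 1 ≤ b₂ := by
        obtain ⟨_, _, -, -, -, h1, -⟩ := id hz₂
        rw [← hproj i'] at h1 hne
        obtain ⟨b₂, hb₂⟩ := projMat_ne_ninf.1 h1
        refine ⟨b₂, hb₂, Nat.one_le_iff_ne_zero.2 fun h0 => hne ?_⟩
        rw [projMat, hb₂, h0]
        simp [Omega.ofWeight]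
      obtain ⟨b₂, hb₂, hb₂'⟩ := hb₂
      obtain ⟨p'', q'', h1⟩ := hrun i'
      obtain ⟨z₁, hz₁, b₁, hb₁, hv₁⟩ := ih i' (h := h) hnode h1 ⟨z₂, hz₂⟩ (hch i')
      change V i ≤ _ at hv₁
      set c' := (4 * Fintype.card (R × R) + 2) ^ h * K
      rcases le_total b₁ b₂ with h12 | h12
      · exact ⟨z₂, b₂, by nlinarith [Nat.mul_le_mul_left c' h12, Nat.mul_le_mul_left c' hb₂'],
          fun _ => hz₂, fun _ => hb₂.ge⟩
      · exact ⟨z₁, b₁, by nlinarith [Nat.mul_le_mul_left c' (hb₂'.trans h12)],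
          fun _ => hz₁, fun _ => hb₁⟩

end Bound

/-! ### Failure of domination yields a fault -/

section NotBigO

variable {α Q R : Type*} [Fintype Q] [Fintype R]
  {A : MaxPlusAutomaton α Q} {B : MaxPlusAutomaton α R}

theorem exists_nat_bound {ι : Type*} [Finite ι] (f : ι → WithBot ℕ) :
    ∃ K : ℕ, ∀ i, f i ≤ (K : WithBot ℕ) := by
  obtain ⟨M, hM⟩ := Finite.exists_le f
  refine ⟨M.unbotD 0, fun i => (hM i).trans ?_⟩
  cases M with
  | bot => exact bot_le
  | coe m => exact le_rfl

theorem exists_list_subtype {S : Type*} {P : S → Prop} (L : List S) (h : ∀ e ∈ L, P e) :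
    ∃ L' : List {e // P e}, L'.map Subtype.val = L :=
  ⟨L.pmap Subtype.mk h, by simp [List.map_pmap]⟩

/-- If `A` is not big-O of `B`, then some word has a factorisation tree of bounded height with a
fault. -/
theorem exists_fault_of_not_isBigO [Finite α] (hB : ∀ w : List α, B.weight w ≠ ⊥)
    (h : ¬ A.IsBigO B) : ∃ (w : List α) (t : FactTree (pathSemigroup A B)),
      IsFactTreeOn A B w t ∧ t.height ≤ 3 * Nat.card (pathSemigroup A B) ∧ HasFault A B t := by
  by_contra! hcon
  apply h
  obtain ⟨K, hK⟩ := exists_nat_bound fun z : α × Q × Q => A.M z.1 z.2.1 z.2.2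
  obtain ⟨KI, hKI⟩ := exists_nat_bound A.I
  obtain ⟨KF, hKF⟩ := exists_nat_bound A.F
  set c₀ := (4 * Fintype.card (R × R) + 2) ^ (3 * Nat.card (pathSemigroup A B)) * K with hc₀
  refine ⟨c₀ + KI + KF + 1, by omega, fun w => ?_⟩
  by_cases hA : A.weight w = ⊥
  · rw [hA]; exact bot_le
  obtain ⟨p, q, hpq⟩ := exists_mpForm_eq hA
  change A.weight w = _ at hpq
  rw [hpq] at hA ⊢
  obtain ⟨v, hv⟩ := exists_nat_of_ne_bot (x := A.wordMat w p q) fun h => by simp [h] at hA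
  have hIp : A.I p ≠ ⊥ := fun h => by simp [h] at hA
  have hFq : A.F q ≠ ⊥ := fun h => by simp [h] at hA
  obtain ⟨β, hβ⟩ := exists_nat_of_ne_bot (hB w)
  suffices H : v ≤ c₀ * β + c₀ by
    rw [hβ, hv]
    calc A.I p + (v : WithBot ℕ) + A.F q ≤ (KI : WithBot ℕ) + (v : WithBot ℕ) + (KF : WithBot ℕ) :=
          add_le_add (add_le_add (hKI p) le_rfl) (hKF q)
      _ ≤ _ := by
        norm_cast
        nlinarith [Nat.zero_le (KI * β), Nat.zero_le (KF * β)]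
  obtain ⟨L, hL⟩ := exists_weightedRun (A := A) B w p q v hv
  obtain ⟨L', rfl⟩ : ∃ L' : List (pathSemigroup A B), L'.map Subtype.val = L :=
    exists_list_subtype L fun e he =>
      Subsemigroup.subset_closure (hL.isRun.mem_letterElts e he)
  by_cases hnil : L' = []
  · subst hnil
    cases hL
    exact Nat.zero_le _
  have : Finite (pathSemigroup A B) := Subtype.finite
  obtain ⟨t, ht, rfl, hth⟩ := exists_factTree hnil
  have hlab := hL.tree_label_eq ht
  have hbot : t.label.1 ≠ .bot := by rw [hlab]; simp
  have hmat : t.label.1.mat = projMat (B.wordMat w) := by rw [hlab]; rfl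
  -- The root has a contributor because the weight of `w` in `B` is not `-∞`.
  have hne : (rootContrib B t.label.1.mat).Nonempty := by
    obtain ⟨i, j, hij⟩ := exists_mpForm_eq (hB w)
    have hBw := hB w
    rw [MaxPlusAutomaton.weight, hij] at hBw
    refine ⟨(i, j), fun h => by simp [h] at hBw, fun h => by simp [h] at hBw, ?_⟩
    rw [hmat, projMat_ne_ninf]
    exact exists_nat_of_ne_bot fun h => by simp [h] at hBw
  obtain ⟨⟨i, j⟩, ⟨hI, hF, -⟩, b, hb, hvb⟩ := IsNode.isBounded ht hbot
    (hcon w t ⟨ht, p, q, hIp, hFq, hL.isRun⟩ hth)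
    (fun a p q => hK (a, p, q)) t .root hL hne hth
  refine hvb.trans ?_
  have hle : (b : WithBot ℕ) ≤ β := by
    rw [← hβ]
    refine le_trans ?_ (le_mpForm B.I (B.wordMat w) B.F i j)
    obtain ⟨x, hx⟩ := exists_nat_of_ne_bot hI
    obtain ⟨y, hy⟩ := exists_nat_of_ne_bot hF
    calc (b : WithBot ℕ) ≤ (x : WithBot ℕ) + (b : WithBot ℕ) + (y : WithBot ℕ) := by
          norm_cast; omega
      _ ≤ _ := by
          simp only at hI hx hy
          rw [hx, hy]
          exact add_le_add (add_le_add le_rfl hb) le_rfl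
  have hle' : b ≤ β := by exact_mod_cast hle
  exact Nat.add_le_add_right (Nat.mul_le_mul_left _ hle') _

end NotBigO

/-! ### Asymptotic behaviours are realised by words -/

section Realisation

variable {α Q R : Type*} [Fintype Q] [Fintype R]
  {A : MaxPlusAutomaton α Q} {B : MaxPlusAutomaton α R}

theorem projMat_wordMat_replicate {w : List α}
    (h : mpMul (projMat (B.wordMat w)) (projMat (B.wordMat w)) = projMat (B.wordMat w)) {n : ℕ}
    (hn : 0 < n) :
    projMat (B.wordMat (List.replicate n w).flatten) = projMat (B.wordMat w) := by
  obtain ⟨n, rfl⟩ := Nat.exists_eq_succ_of_ne_zero hn.ne'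
  clear hn
  induction n with
  | zero => simp
  | succ n ih =>
    rw [List.replicate_succ, List.flatten_cons, MaxPlusAutomaton.wordMat_append, projMat_mpMul,
      ih, h]

theorem mul_le_wordMat_replicate {w : List α} {p : Q} {v : ℕ}
    (h : (v : WithBot ℕ) ≤ A.wordMat w p p) (n : ℕ) :
    ((n * v : ℕ) : WithBot ℕ) ≤ A.wordMat (List.replicate n w).flatten p p := by
  induction n with
  | zero => simp [MaxPlusAutomaton.wordMat]
  | succ n ih =>
    rw [List.replicate_succ, List.flatten_cons, Nat.succ_mul, add_comm]
    exact add_le_wordMat_append h ih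

/-- If every recurrent transition between `i` and `j` has weight at most `s`, then an entry of the
`n`-th power exceeds `n * s` by a bounded amount only. -/
theorem wordMat_replicate_le {w : List α} {P : Matrix R R Omega}
    (hw : projMat (B.wordMat w) = P) (hP : mpMul P P = P) {m s : ℕ}
    (hm : ∀ a b, B.wordMat w a b ≤ (m : WithBot ℕ)) {i j : R}
    (hs : ∀ a b (β : ℕ), P i a ≠ Omega.ninf → P b j ≠ Omega.ninf → P a b ≠ Omega.ninf →
      P b a ≠ Omega.ninf → B.wordMat w a b = β → β ≤ s) (n b : ℕ)
    (hb : B.wordMat (List.replicate n w).flatten i j = b) : b ≤ m * Fintype.card R + n * s := by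
  classical
  have htrans : ∀ {a b c}, P a b ≠ Omega.ninf → P b c ≠ Omega.ninf → P a c ≠ Omega.ninf :=
    fun {a b c} h1 h2 => by rw [← hP]; exact mpMul_ne_ninf.2 ⟨b, h1, h2⟩
  -- The number of states reachable from `a` serves as a potential. A step from `a` that cannot be
  -- reversed loses at least `a` from the set, so there are at most `Fintype.card R` such steps,
  -- each of weight at most `m`; every other step is recurrent and weighs at most `s`. Counting `a`
  -- itself makes the loss strict.
  set reach : R → Finset R := fun a => Finset.univ.filter fun b => b = a ∨ P a b ≠ Omega.ninf
    with hreach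
  suffices H : ∀ n a b, (a = i ∨ P i a ≠ Omega.ninf) →
      B.wordMat (List.replicate n w).flatten a j = (b : ℕ) → b ≤ m * (reach a).card + n * s by
    refine (H n i b (.inl rfl) hb).trans (Nat.add_le_add_right (Nat.mul_le_mul_left _ ?_) _)
    exact Finset.card_le_univ _
  clear hb n b
  intro n
  induction n with
  | zero =>
    intro a b _ hb
    simp only [List.replicate_zero, List.flatten_nil, MaxPlusAutomaton.wordMat] at hb
    split_ifs at hb with haj
    · have : 0 = b := by exact_mod_cast hb
      omega
    · simp at hb
  | succ n ih =>
    intro a b ha hb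
    rw [List.replicate_succ, List.flatten_cons, MaxPlusAutomaton.wordMat_append] at hb
    have hne : mpMul (B.wordMat w) (B.wordMat (List.replicate n w).flatten) a j ≠ ⊥ := by
      rw [hb]; exact WithBot.coe_ne_bot
    obtain ⟨k, hk⟩ := exists_mpMul_eq hne
    rw [hk] at hne
    obtain ⟨β, hβ⟩ := exists_nat_of_ne_bot (x := B.wordMat w a k) fun h => by simp [h] at hne
    obtain ⟨b', hb'⟩ := exists_nat_of_ne_bot
      (x := B.wordMat (List.replicate n w).flatten k j) fun h => by simp [h] at hne
    rw [hb, hβ, hb'] at hk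
    have hsum : b = β + b' := by exact_mod_cast hk
    have hPak : P a k ≠ Omega.ninf := by rw [← hw]; exact projMat_ne_ninf.2 ⟨β, hβ⟩
    have hik : P i k ≠ Omega.ninf := by
      rcases ha with rfl | ha
      · exact hPak
      · exact htrans ha hPak
    have hih := ih k b' (.inr hik) hb'
    have hsub : reach k ⊆ reach a := by
      intro x hx
      simp only [hreach, Finset.mem_filter, Finset.mem_univ, true_and] at hx ⊢
      rcases hx with rfl | hx
      · exact .inr hPak
      · exact .inr (htrans hPak hx)
    by_cases hka : P k a = Omega.ninf
    · have hnot : a ∉ reach k := by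
        simp only [hreach, Finset.mem_filter, Finset.mem_univ, true_and]
        rintro (rfl | h)
        · exact hPak hka
        · exact h hka
      have hlt : (reach k).card < (reach a).card :=
        Finset.card_lt_card ⟨hsub, fun h => hnot (h (by simp [hreach]))⟩
      have hβm : β ≤ m := by
        have := hm a k
        rw [hβ] at this
        exact_mod_cast this
      have := Nat.mul_le_mul_left m (Nat.succ_le_of_lt hlt)
      rw [Nat.succ_eq_add_one] at this
      nlinarith
    · have hkj : P k j ≠ Omega.ninf := by
        rcases Nat.eq_zero_or_pos n with rfl | hn
        · simp only [List.replicate_zero, List.flatten_nil, MaxPlusAutomaton.wordMat] at hb'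
          split_ifs at hb' with hkj
          · subst hkj; exact htrans hka hPak
          · simp at hb'
        · rw [← hw, ← projMat_wordMat_replicate (by rw [hw, hP]) hn]
          exact projMat_ne_ninf.2 ⟨b', hb'⟩
      have hia : P i a ≠ Omega.ninf := htrans hik hka
      have hβs := hs a k β hia hkj hPak hka hβ
      have := Nat.mul_le_mul_left m (Finset.card_le_card hsub)
      nlinarith

/-- The element `(p, x, q, M)` describes words: their runs from `p` to `q` have weight at least `1`
if `x ≠ 0`, and if `x = ∞` the weight dominates all the entries at which `M` is finite. -/
def IsRealised (A : MaxPlusAutomaton α Q) (B : MaxPlusAutomaton α R) (p : Q) (x : Omega) (q : Q)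
    (M : Matrix R R Omega) : Prop :=
  x ≠ Omega.ninf ∧ ∀ c : ℕ, ∃ (w : List α) (v : ℕ), (v : WithBot ℕ) ≤ A.wordMat w p q ∧
    projMat (B.wordMat w) = barMat M ∧ (x ≠ Omega.zero → 1 ≤ v) ∧
    (x = Omega.inf → ∀ i j (b : ℕ), M i j ≠ Omega.inf → B.wordMat w i j = b → c * b + c ≤ v)

theorem exists_wordMat_bound (B : MaxPlusAutomaton α R) (w : List α) :
    ∃ m : ℕ, ∀ a b, B.wordMat w a b ≤ (m : WithBot ℕ) := by
  obtain ⟨m, hm⟩ := exists_nat_bound fun z : R × R => B.wordMat w z.1 z.2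
  exact ⟨m, fun a b => hm (a, b)⟩

/-- If only one factor has value `∞`, the word of the other is fixed beforehand; its entries are
bounded by some `m`, and the dominating word is then taken for the constant `c * (m + 1)`. If both
values are `∞`, the two dominations add up. -/
theorem IsRealised.mul {p q s : Q} {x y : Omega} {M N : Matrix R R Omega}
    (h : IsRealised A B p x q M) (h' : IsRealised A B q y s N) :
    IsRealised A B p (x + y) s (mpMul M N) := by
  obtain ⟨hx, h⟩ := h
  obtain ⟨hy, h'⟩ := h'
  refine ⟨by rw [Ne, Omega.add_eq_ninf]; tauto, fun c => ?_⟩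
  obtain ⟨w₁, v₁, w₂, v₂, ⟨h1, h2, h3⟩, ⟨h1', h2', h3'⟩, hc⟩ : ∃ (w₁ : List α) (v₁ : ℕ)
      (w₂ : List α) (v₂ : ℕ),
      ((v₁ : WithBot ℕ) ≤ A.wordMat w₁ p q ∧ projMat (B.wordMat w₁) = barMat M ∧
        (x ≠ Omega.zero → 1 ≤ v₁)) ∧
      ((v₂ : WithBot ℕ) ≤ A.wordMat w₂ q s ∧ projMat (B.wordMat w₂) = barMat N ∧
        (y ≠ Omega.zero → 1 ≤ v₂)) ∧
      (x + y = Omega.inf → ∀ i j k (b₁ b₂ : ℕ), (x = Omega.inf → M i k ≠ Omega.inf) →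
        (y = Omega.inf → N k j ≠ Omega.inf) → B.wordMat w₁ i k = b₁ → B.wordMat w₂ k j = b₂ →
        c * (b₁ + b₂) + c ≤ v₁ + v₂) := by
    by_cases hxi : x = Omega.inf
    · by_cases hyi : y = Omega.inf
      · obtain ⟨w₁, v₁, h1, h2, h3, h4⟩ := h c
        obtain ⟨w₂, v₂, h1', h2', h3', h4'⟩ := h' c
        refine ⟨w₁, v₁, w₂, v₂, ⟨h1, h2, h3⟩, ⟨h1', h2', h3'⟩, ?_⟩
        intro _ i j k b₁ b₂ e1 e2 e3 e4
        have := h4 hxi i k b₁ (e1 hxi) e3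
        have := h4' hyi k j b₂ (e2 hyi) e4
        nlinarith
      · obtain ⟨w₂, v₂, h1', h2', h3', h4'⟩ := h' 0
        obtain ⟨m, hm⟩ := exists_wordMat_bound B w₂
        obtain ⟨w₁, v₁, h1, h2, h3, h4⟩ := h (c * (m + 1))
        refine ⟨w₁, v₁, w₂, v₂, ⟨h1, h2, h3⟩, ⟨h1', h2', h3'⟩, ?_⟩
        intro _ i j k b₁ b₂ e1 e2 e3 e4
        have h5 := h4 hxi i k b₁ (e1 hxi) e3
        have h6 := hm k j
        rw [e4] at h6
        have h6 : b₂ ≤ m := by exact_mod_cast h6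
        nlinarith [Nat.mul_le_mul_left c h6, Nat.zero_le (c * m * b₁)]
    · obtain ⟨w₁, v₁, h1, h2, h3, h4⟩ := h 0
      obtain ⟨m, hm⟩ := exists_wordMat_bound B w₁
      obtain ⟨w₂, v₂, h1', h2', h3', h4'⟩ := h' (c * (m + 1))
      refine ⟨w₁, v₁, w₂, v₂, ⟨h1, h2, h3⟩, ⟨h1', h2', h3'⟩, ?_⟩
      intro hxy i j k b₁ b₂ e1 e2 e3 e4
      have hyi : y = Omega.inf := by
        rcases Omega.add_eq_inf.1 hxy with h | h
        · exact absurd h.1 hxi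
        · exact h.2
      have h5 := h4' hyi k j b₂ (e2 hyi) e4
      have h6 := hm i k
      rw [e3] at h6
      have h6 : b₁ ≤ m := by exact_mod_cast h6
      nlinarith [Nat.mul_le_mul_left c h6, Nat.zero_le (c * m * b₂)]
  refine ⟨w₁ ++ w₂, v₁ + v₂, add_le_wordMat_append h1 h1', ?_, ?_, ?_⟩
  · rw [MaxPlusAutomaton.wordMat_append, projMat_mpMul, h2, h2', barMat_mpMul]
  · intro hxy
    by_cases hx0 : x = Omega.zero
    · have : y ≠ Omega.zero := by rintro rfl; subst hx0; exact hxy rfl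
      have := h3' this
      omega
    · have := h3 hx0
      omega
  · intro hxy i j b hinf hb
    rw [MaxPlusAutomaton.wordMat_append] at hb
    have hne : mpMul (B.wordMat w₁) (B.wordMat w₂) i j ≠ ⊥ := by
      rw [hb]; exact WithBot.coe_ne_bot
    obtain ⟨k, hk⟩ := exists_mpMul_eq hne
    rw [hk] at hne
    obtain ⟨b₁, hb₁⟩ := exists_nat_of_ne_bot (x := B.wordMat w₁ i k) fun h => by simp [h] at hne
    obtain ⟨b₂, hb₂⟩ := exists_nat_of_ne_bot (x := B.wordMat w₂ k j) fun h => by simp [h] at hne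
    rw [hb, hb₁, hb₂] at hk
    have hsum : b = b₁ + b₂ := by exact_mod_cast hk
    have hM : M i k ≠ Omega.ninf := by
      rw [Ne, ← barMat_eq_ninf, ← h2]; exact projMat_ne_ninf.2 ⟨_, hb₁⟩
    have hN : N k j ≠ Omega.ninf := by
      rw [Ne, ← barMat_eq_ninf, ← h2']; exact projMat_ne_ninf.2 ⟨_, hb₂⟩
    rw [hsum]
    exact hc hxy i j k b₁ b₂ (fun _ h => hinf (mpMul_eq_inf.2 ⟨k, .inl ⟨h, hN⟩⟩))
      (fun _ h => hinf (mpMul_eq_inf.2 ⟨k, .inr ⟨hM, h⟩⟩)) hb₁ hb₂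

/-- A step `(a, b)` of value `1` that can be reversed gives a diagonal entry at least `1` at `a`, by
path-idempotency, and stabilisation turns it into `∞`. -/
theorem IsPathIdemMat.stabMat_eq_inf {M : Matrix R R Omega} (hM : IsPathIdemMat M) {i j a b : R}
    (hia : M i a ≠ Omega.ninf) (hab : barMat M a b = Omega.one) (hba : M b a ≠ Omega.ninf)
    (hbj : M b j ≠ Omega.ninf) : stabMat M i j = Omega.inf := by
  have haj : M a j ≠ Omega.ninf :=
    hM.trans_ne_ninf (by rw [Ne, ← barMat_eq_ninf, hab]; decide) hbj
  have haa : (M a a).stab = Omega.inf := by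
    have h1 : barMat M a b + barMat M b a ≤ barMat M a a := by
      have := Finset.le_sup (f := fun k => barMat M a k + barMat M k a) (Finset.mem_univ b)
      exact this.trans_eq (congrFun (congrFun hM a) a)
    rw [hab] at h1
    simp only [barMat] at h1
    revert h1 hba
    generalize M b a = u
    generalize M a a = u'
    revert u u'
    decide
  refine mpMul_eq_inf.2 ⟨a, .inl ⟨mpMul_eq_inf.2 ⟨a, .inr ⟨hia, ?_⟩⟩, haj⟩⟩
  rw [stabDiag, if_pos rfl, haa]

/-- The way back from `b` to `a` splits in two by path-idempotency, so the `∞` at `(a, b)` lies on a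
cycle of exactly three steps and reaches the diagonal of the cube. -/
theorem IsPathIdemMat.flatMat_eq_inf {M : Matrix R R Omega} (hM : IsPathIdemMat M) {i j a b : R}
    (hia : M i a ≠ Omega.ninf) (hab : M a b = Omega.inf) (hba : M b a ≠ Omega.ninf)
    (hbj : M b j ≠ Omega.ninf) : flatMat M i j = Omega.inf := by
  have haj : M a j ≠ Omega.ninf := hM.trans_ne_ninf (by rw [hab]; decide) hbj
  obtain ⟨k, hbk, hka⟩ : ∃ k, M b k ≠ Omega.ninf ∧ M k a ≠ Omega.ninf := by
    rw [Ne, ← barMat_eq_ninf, ← hM] at hba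
    obtain ⟨k, h1, h2⟩ := mpMul_ne_ninf.1 hba
    exact ⟨k, by rwa [Ne, barMat_eq_ninf] at h1, by rwa [Ne, barMat_eq_ninf] at h2⟩
  refine mpMul_eq_inf.2 ⟨a, .inl ⟨mpMul_eq_inf.2 ⟨a, .inr ⟨?_, ?_⟩⟩, ?_⟩⟩
  · rwa [Ne, barMat_eq_ninf]
  · rw [barOffDiag, if_pos rfl]
    exact mpMul_eq_inf.2 ⟨k, .inl ⟨mpMul_eq_inf.2 ⟨b, .inl ⟨hab, hbk⟩⟩, hka⟩⟩
  · rwa [Ne, barMat_eq_ninf]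

/-- If `x ≠ 0`, the `A`-weight of a power of `w` grows with the exponent. At an entry of the
stabilisation that is not `∞`, all recurrent steps have weight `0`, so the entry stays below `m *
Fintype.card R` for all powers. -/
theorem IsRealised.stab {p : Q} {x : Omega} {M : Matrix R R Omega} (hM : IsPathIdemMat M)
    (h : IsRealised A B p x p M) : IsRealised A B p x.stab p (stabMat M) := by
  obtain ⟨hx, h⟩ := h
  refine ⟨by revert hx; cases x <;> decide, fun c => ?_⟩
  obtain ⟨w, v, h1, h2, h3, -⟩ := h 0
  by_cases hx0 : x = Omega.zero
  · subst hx0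
    exact ⟨w, v, h1, by rw [h2, barMat_stabMat hM], fun h => absurd rfl h,
      fun h => by cases h⟩
  have hv := h3 hx0
  obtain ⟨m, hm⟩ := exists_wordMat_bound B w
  set n := c * (m * Fintype.card R) + c + 1 with hn
  have hidem : mpMul (projMat (B.wordMat w)) (projMat (B.wordMat w)) = projMat (B.wordMat w) := by
    rw [h2]; exact hM
  have hnv : n ≤ n * v := Nat.le_mul_of_pos_right _ hv
  refine ⟨_, n * v, mul_le_wordMat_replicate h1 n, ?_, fun _ => by omega, ?_⟩
  · rw [projMat_wordMat_replicate hidem (by omega), h2, barMat_stabMat hM]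
  intro _ i j b hinf hb
  have hb := wordMat_replicate_le h2 hM (s := 0) hm (fun a b β hia hbj hab hba hβ => ?_) n b hb
  · have := Nat.mul_le_mul_left c hb
    rw [Nat.mul_zero, Nat.add_zero] at this
    omega
  · by_contra hβ0
    refine hinf (hM.stabMat_eq_inf (a := a) (b := b) ?_ ?_ ?_ ?_)
    · rwa [Ne, ← barMat_eq_ninf]
    · rw [← h2, projMat, hβ, Omega.ofWeight_coe, if_neg (by omega)]
    · rwa [Ne, ← barMat_eq_ninf]
    · rwa [Ne, ← barMat_eq_ninf]

/-- At an entry that is not `∞`, recurrent steps weigh at most `v / (2c + 1)`. In `w^n` they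
contribute, after multiplication by `c`, at most half of `n * v`; the other half covers the bounded
excess once `n` is large. -/
theorem IsRealised.flat {p : Q} {x : Omega} {M : Matrix R R Omega} (hM : IsPathIdemMat M)
    (h : IsRealised A B p x p M) : IsRealised A B p x p (flatMat M) := by
  obtain ⟨hx, h⟩ := h
  refine ⟨hx, fun c => ?_⟩
  obtain ⟨w, v, h1, h2, h3, h4⟩ := h (2 * c + 1)
  by_cases hxi : x ≠ Omega.inf
  · exact ⟨w, v, h1, by rw [h2, barMat_flatMat hM], h3, fun h => absurd h hxi⟩
  rw [not_not] at hxi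
  have hv := h3 (by rw [hxi]; decide)
  obtain ⟨m, hm⟩ := exists_wordMat_bound B w
  set n := 2 * c * (m * Fintype.card R + 1) + 1 with hn
  have hidem : mpMul (projMat (B.wordMat w)) (projMat (B.wordMat w)) = projMat (B.wordMat w) := by
    rw [h2]; exact hM
  have hnv : n ≤ n * v := Nat.le_mul_of_pos_right _ hv
  refine ⟨_, n * v, mul_le_wordMat_replicate h1 n, ?_, fun _ => by omega, ?_⟩
  · rw [projMat_wordMat_replicate hidem (by omega), h2, barMat_flatMat hM]
  intro _ i j b hinf hb
  have hb := wordMat_replicate_le h2 hM (s := v / (2 * c + 1)) hm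
    (fun a b β hia hbj hab hba hβ => ?_) n b hb
  · set s := v / (2 * c + 1) with hs
    have hsv : (2 * c + 1) * s ≤ v := Nat.mul_div_le _ _
    have e1 := Nat.mul_le_mul_left (2 * c) hb
    have e2 := Nat.mul_le_mul_left n hsv
    have e3 : 2 * c * (n * s) ≤ n * v := by nlinarith [Nat.zero_le (n * s)]
    have e4 : 2 * c * (m * Fintype.card R) + 2 * c + 1 = n := by rw [hn]; ring
    have e5 : 2 * (c * b + c) ≤ 2 * (n * v) := by
      calc 2 * (c * b + c) = 2 * c * b + 2 * c := by ring
        _ ≤ 2 * c * (m * Fintype.card R + n * s) + 2 * c := Nat.add_le_add_right e1 _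
        _ = 2 * c * (m * Fintype.card R) + 2 * c + 2 * c * (n * s) := by ring
        _ ≤ n * v + n * v := Nat.add_le_add (by omega) e3
        _ = 2 * (n * v) := by ring
    omega
  · rw [Nat.le_div_iff_mul_le (by omega), Nat.mul_comm]
    refine (Nat.le_add_right _ _).trans (h4 hxi a b β (fun hinf' => ?_) hβ)
    refine hinf (hM.flatMat_eq_inf (a := a) (b := b) ?_ hinf' ?_ ?_) <;>
      rwa [Ne, ← barMat_eq_ninf]

theorem IsAsymptotic.isRealised {e : PathElt Q R} (he : IsAsymptotic A B e) :
    ∀ p x q M, e = .mk p x q M → IsRealised A B p x q M := by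
  induction he with
  | letter h =>
    obtain ⟨a, p', q', hne, rfl⟩ := h
    rintro p x q M heq
    cases heq
    obtain ⟨v, hv⟩ := exists_nat_of_ne_bot hne
    refine ⟨by rwa [Ne, Omega.ofWeight_eq_ninf], fun c => ⟨[a], v, ?_, ?_, ?_, ?_⟩⟩
    · rw [MaxPlusAutomaton.wordMat_singleton, hv]
    · rw [MaxPlusAutomaton.wordMat_singleton, barMat_projMat]
    · rw [hv, Omega.ofWeight_coe]
      intro h
      by_contra h0
      exact h (if_pos (by omega))
    · intro h
      rw [← Omega.bar_ofWeight] at h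
      exact absurd h (Omega.bar_ne_inf _)
  | mul _ _ ih₁ ih₂ =>
    rintro p x q M heq
    obtain ⟨_, _, _, _, _, _, _, rfl, rfl⟩ := PathElt.mul_ne_bot (by rw [heq]; simp)
    rw [PathElt.mk_mul_mk] at heq
    cases heq
    exact (ih₁ _ _ _ _ rfl).mul (ih₂ _ _ _ _ rfl)
  | @stab e _ hi ih =>
    rintro p x q M heq
    cases e with
    | bot => exact hi.elim
    | mk p' x' q' M' =>
      cases heq
      obtain ⟨rfl, hM⟩ := hi
      exact (ih _ _ _ _ rfl).stab hM
  | @flat e _ hi ih =>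
    rintro p x q M heq
    cases e with
    | bot => exact hi.elim
    | mk p' x' q' M' =>
      cases heq
      obtain ⟨rfl, hM⟩ := hi
      exact (ih _ _ _ _ rfl).flat hM

/-- A witness of non-domination refutes domination. -/
theorem not_isBigO_of_isWitness {g : PathElt Q R} (hg : IsWitness A B g) : ¬ A.IsBigO B := by
  rintro ⟨c, hc, hdom⟩
  obtain ⟨hS, p, q, M, rfl, hp, hq, hform⟩ := hg
  obtain ⟨KI, hKI⟩ := exists_nat_bound B.I
  obtain ⟨KF, hKF⟩ := exists_nat_bound B.F
  -- The factor `KI + KF + 1` absorbs the initial and final weights of `B`, and the last `+ 1` makes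
  -- the contradiction strict.
  obtain ⟨w, v, h1, h2, h3, h4⟩ := (hS.isRealised _ _ _ _ rfl).2 (c * (KI + KF + 1) + 1)
  obtain ⟨x, hx⟩ := exists_nat_of_ne_bot hp
  obtain ⟨y, hy⟩ := exists_nat_of_ne_bot hq
  have hA : (v : WithBot ℕ) ≤ A.weight w := by
    refine le_trans ?_ (le_mpForm A.I (A.wordMat w) A.F p q)
    calc (v : WithBot ℕ) ≤ (x : WithBot ℕ) + (v : WithBot ℕ) + (y : WithBot ℕ) := by
          norm_cast; omega
      _ ≤ _ := by
          rw [hx, hy]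
          exact add_le_add (add_le_add le_rfl h1) le_rfl
  have hle := hA.trans (hdom w)
  have hB : B.weight w ≠ ⊥ := by
    intro h
    -- In `WithBot ℕ` the product `0 * ⊥` is `0`; positivity of `c` is what makes the right-hand
    -- side `⊥` here.
    rw [h, WithBot.mul_bot (by exact_mod_cast hc.ne'), WithBot.bot_add] at hle
    simp at hle
  obtain ⟨i, j, hij⟩ := exists_mpForm_eq hB
  have hBij : B.weight w = B.I i + B.wordMat w i j + B.F j := hij
  have hB' := hB
  rw [hBij] at hB'
  obtain ⟨b, hb⟩ := exists_nat_of_ne_bot (x := B.wordMat w i j) fun h => by simp [h] at hB'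
  have hI : Omega.ofWeight (B.I i) ≠ Omega.ninf := fun h => by
    rw [Omega.ofWeight_eq_ninf] at h; simp [h] at hB'
  have hF : Omega.ofWeight (B.F j) ≠ Omega.ninf := fun h => by
    rw [Omega.ofWeight_eq_ninf] at h; simp [h] at hB'
  have hM : M i j ≠ Omega.inf := by
    intro hinf
    rw [Omega.lt_inf] at hform
    refine hform (Omega.finset_sup_eq_inf.2 ⟨i, Finset.mem_univ _,
      Omega.finset_sup_eq_inf.2 ⟨j, Finset.mem_univ _, ?_⟩⟩)
    exact Omega.add_eq_inf.2 (.inl ⟨Omega.add_eq_inf.2 (.inr ⟨hI, hinf⟩), hF⟩)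
  have hv := h4 rfl i j b hM hb
  obtain ⟨β, hβ⟩ := exists_nat_of_ne_bot hB
  have hβle : β ≤ KI + b + KF := by
    have : (β : WithBot ℕ) ≤ (KI : WithBot ℕ) + (b : WithBot ℕ) + (KF : WithBot ℕ) := by
      rw [← hβ, hBij, hb]
      exact add_le_add (add_le_add (hKI i) le_rfl) (hKF j)
    exact_mod_cast this
  rw [hβ] at hle
  have hle' : v ≤ c * β + c := by exact_mod_cast hle
  have := Nat.mul_le_mul_left c hβle
  nlinarith [Nat.zero_le (c * (KI + KF) * b)]

end Realisation

theorem mainTheorem3 {α QA QB : Type*} [Finite α] [Fintype QA] [Fintype QB]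
    (A : MaxPlusAutomaton α QA) (B : MaxPlusAutomaton α QB)
    (hA : A.IsDeterministic) (hB : ∀ w : List α, B.weight w ≠ ⊥) :
    List.TFAE [
      ¬ A.IsBigO B,
      ∃ g, IsWitness A B g,
      ∃ g, IsTractableWitness A B g,
      ∃ (w : List α) (t : FactTree (pathSemigroup A B)),
        IsFactTreeOn A B w t ∧ t.height ≤ 3 * Nat.card (pathSemigroup A B) ∧ HasFault A B t] := by
  tfae_have 1 → 4 := exists_fault_of_not_isBigO hB
  tfae_have 4 → 3 := fun ⟨_, _, ht, hh, hf⟩ => exists_tractableWitness_of_fault ht hh hf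
  tfae_have 3 → 2 := fun ⟨g, hg⟩ => ⟨g, hg.1⟩
  tfae_have 2 → 1 := fun ⟨_, hg⟩ => not_isBigO_of_isWitness hg
  tfae_finish
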